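/- Let $n\ge 2$. A bounded domain $D\subset\mathbb R^n$ with $0\in D$ is strictly starlike (with respect to $0$) if every ray from $0$ meets $\partial D$ in exactly one point. Let $\mathcal M=\partial D$. For $x\in\mathbb R^n\setminus\{0\}$ let $r_x=|w|$, where $w$ is the unique point of $\mathcal M$ on the ray $\{sx:s>0\}$. The quasi-inversion in $\mathcal M$ is $f_{\mathcal M}(x)=\frac{r_x^2}{|x|^2}x$ for $x\in\mathbb R^n\setminus\{0\}$, $f_{\mathcal M}(0)=\infty$, $f_{\mathcal M}(\infty)=0$. For distinct $x,z\in\mathcal M$ let $\alpha(z,x)\in[0,\pi/2]$ be the acute angle which the segment $[z,x]$ makes with the ray from $0$ through $x$, and let $\alpha(x)=\liminf_{z\to x,\,z\in\mathcal M\setminus\{x\}}\alpha(z,x)$. For $\alpha\in(0,\pi/2]$, $D$ satisfies the $\alpha$-tangent condition if $\alpha(x)\ge\alpha$ for every $x\in\mathcal M$. A homeomorphism $f:U\to V$ of open subsets of $\mathbb R^n$ is quasiconformal if it is ACL, differentiable a.e., and $\Lambda_f(x)^n/C\le |J(x,f)|\le C\lambda_f(x)^n$ for a.e. $x\in U$ and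 some constant $C$, where $\Lambda_f(x)=\max_{|h|=1}|f'(x)h|$ and $\lambda_f(x)=\min_{|h|=1}|f'(x)h|$. It is $K$-quasiconformal if moreover $J(x,f)\neq 0$ and $\Lambda_f(x)/\lambda_f(x)\le K$ for a.e. $x\in U$. For $n=2$, $\mathbb R^2=\mathbb C$, it is $k$-quasiconformal if it is quasiconformal and for a.e. $z\in U$ one has $J(z,f)\ne0$ and $|\mu_f(z)|\le k$ where $f$ is sense-preserving, $|\mu_{\bar f}(z)|\le k$ where $f$ is sense-reversing; here $\mu_f=f_{\bar z}/f_z$. ($K$-quasiconformality corresponds to $k=(K-1)/(K+1)$.) **Theorem.** (1) Let $D\subset\mathbb R^n$ be strictly starlike and satisfy the $\alpha$-tangent condition, and let $\mathcal M=\partial D$. Then $f_{\mathcal M}$ is a homeomorphism of $\mathbb R^n\cup\{\infty\}$ onto itself, and its restriction $\mathbb R^n\setminus\{0\}\to\mathbb R^n\setminus\{0\}$ is $K$-quasiconformal with $K=\cot^2\frac{\alpha}{2}$. (2) If $n=2$, then under the same assumptions $f_{\mathcal M}$ is $k$-quasiconformal in $\mathbb R^2\setminus\{0\}$ with $k=\frac{K-1}{K+1}=\cos\alpha$.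 (3) For $t\in[0,1]$ let $\mathcal M_t=\partial D_t$, where $D_t\subset\mathbb R^n$ is strictly starlike and satisfies the $\alpha$-tangent condition for some $\alpha\in(0,\pi/2]$ depending on $t$. Let $\varphi_t(x)=r_x x$ ($x\neq 0$), $\varphi_t(0)=0$, with $r_x$ taken with respect to $\mathcal M_t$; this is the radial extension of the inverse $S^{n-1}\to\mathcal M_t$ of the radial projection. Suppose that $\mathcal M_t$ converges smoothly to the sphere $S^{n-1}(r)=\{|x|=r\}$, $r>0$, i.e. $\lim_{t\to0}\operatorname{ess\,sup}_{|x|=1}|\varphi_t'(x)-r\mathbf I|=0$ (operator norm, surface measure). Then, with $\alpha_{\mathcal M_t}=\inf_{x\in\mathcal M_t}\alpha(x)$, the constants $K_t=\cot^2(\alpha_{\mathcal M_t}/2)$ tend to $1$ as $t\to0$, and so do the least constants $K$ for which the $f_{\mathcal M_t}$ are $K$-quasiconformal in $\mathbb R^n\setminus\{0\}$. -/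

import Mathlib

open Set Filter Topology MeasureTheory

namespace QuasiInv

/-- The Euclidean space `ℝⁿ`. -/
abbrev E (n : ℕ) : Type := EuclideanSpace ℝ (Fin n)

/-! ### Strictly starlike domains and the tangent condition -/

/-- The open ray `{t x : t > 0}` from the origin through `x`. -/
def ray {n : ℕ} (x : E n) : Set (E n) := {y | ∃ t : ℝ, 0 < t ∧ y = t • x}

/-- A bounded domain `D` containing the origin is strictly starlike with respect to the origin if
each ray emanating from the origin meets `∂D` at exactly one point. -/
structure IsStrictlyStarlike {n : ℕ} (D : Set (E n)) : Prop where
  isOpen : IsOpen D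
  isConnected : IsConnected D
  isBounded : Bornology.IsBounded D
  zero_mem : (0 : E n) ∈ D
  existsUnique : ∀ x : E n, x ≠ 0 → ∃! w : E n, w ∈ ray x ∩ frontier D

/-- The acute angle (in `[0, π/2]`) which the segment `[z, x]` makes with the ray from `0`
through `x`. -/
noncomputable def acuteAngle {n : ℕ} (z x : E n) : ℝ :=
  min (InnerProductGeometry.angle (z - x) x) (Real.pi - InnerProductGeometry.angle (z - x) x)

/-- `α(x) = liminf α(z, x)` as `z → x`, `z ∈ M`, `z ≠ x`. -/
noncomputable def angleAt {n : ℕ} (M : Set (E n)) (x : E n) : ℝ :=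
  liminf (fun z => acuteAngle z x) (𝓝[M \ {x}] x)

/-- The `α`-tangent condition: `α ∈ (0, π/2]` and `α(x) ≥ α` for all `x ∈ ∂D`. -/
def TangentCondition {n : ℕ} (D : Set (E n)) (α : ℝ) : Prop :=
  0 < α ∧ α ≤ Real.pi / 2 ∧ ∀ x ∈ frontier D, α ≤ angleAt (frontier D) x

/-- The best angle `inf {α(x) : x ∈ M}` of a surface `M`. -/
noncomputable def tangentAngle {n : ℕ} (M : Set (E n)) : ℝ :=
  sInf (angleAt M '' M)

/-! ### The quasi-inversion and the radial extension -/

/-- `r_x = |w|`, where `w` is the unique point of `M` on the ray through `x`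
(so that the set below is a singleton). -/
noncomputable def radius {n : ℕ} (M : Set (E n)) (x : E n) : ℝ :=
  sInf (norm '' (ray x ∩ M))

/-- The quasi-inversion `x ↦ (r_x² / |x|²) x`, on `ℝⁿ \ {0}`. -/
noncomputable def quasiInversion {n : ℕ} (M : Set (E n)) (x : E n) : E n :=
  (radius M x ^ 2 / ‖x‖ ^ 2) • x

/-- The quasi-inversion on `ℝⁿ ∪ {∞}`, with `0 ↦ ∞` and `∞ ↦ 0`. -/
noncomputable def quasiInversionExt {n : ℕ} (M : Set (E n)) : OnePoint (E n) → OnePoint (E n) :=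
  open Classical in
  fun p => p.elim ((0 : E n) : OnePoint (E n))
    (fun x => if x = 0 then OnePoint.infty else (quasiInversion M x : OnePoint (E n)))

/-- The inverse `φ : Sⁿ⁻¹ → M` of the radial projection. -/
noncomputable def polarMap {n : ℕ} (M : Set (E n)) (ω : E n) : E n :=
  radius M ω • ω

/-- The radial extension `x ↦ |x| φ(x / |x|)` (and `0 ↦ 0`) of `φ` to `ℝⁿ`. -/
noncomputable def radialExtension {n : ℕ} (M : Set (E n)) (x : E n) : E n :=
  ‖x‖ • polarMap M (‖x‖⁻¹ • x)

/-! ### Quasiconformal mappings -/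

/-- The largest stretching `Λ = max {|A h| : |h| = 1}`. -/
noncomputable def maxStretch {n : ℕ} (A : E n →L[ℝ] E n) : ℝ :=
  sSup ((fun h => ‖A h‖) '' Metric.sphere (0 : E n) 1)

/-- The smallest stretching `λ = min {|A h| : |h| = 1}`. -/
noncomputable def minStretch {n : ℕ} (A : E n →L[ℝ] E n) : ℝ :=
  sInf ((fun h => ‖A h‖) '' Metric.sphere (0 : E n) 1)

/-- The point whose `k`-th coordinate is `t` and whose other coordinates are given by `y`. -/
noncomputable def linePoint {n : ℕ} (k : Fin n) (y : {i : Fin n // i ≠ k} → ℝ) (t : ℝ) : E n :=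
  WithLp.toLp 2 (fun i => if h : i = k then t else y ⟨i, h⟩)

/-- `f` is absolutely continuous on lines in the open set `U`: it is continuous and, in every
closed interval `Q = ∏ [aᵢ, bᵢ] ⊆ U`, it is absolutely continuous on almost every segment of `Q`
parallel to a coordinate axis. -/
def IsACL {n : ℕ} (f : E n → E n) (U : Set (E n)) : Prop :=
  ContinuousOn f U ∧
  ∀ a b : Fin n → ℝ, (∀ i, a i < b i) → {x : E n | ∀ i, x i ∈ Icc (a i) (b i)} ⊆ U →
    ∀ k : Fin n, ∀ᵐ y : {i : Fin n // i ≠ k} → ℝ,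
      (∀ i : {i : Fin n // i ≠ k}, y i ∈ Icc (a i) (b i)) →
        AbsolutelyContinuousOnInterval (fun t => f (linePoint k y t)) (a k) (b k)

/-- `f : U → V` is a homeomorphism between open subsets of `ℝⁿ`. -/
def IsHomeoOn {n : ℕ} (f : E n → E n) (U V : Set (E n)) : Prop :=
  ∃ e : OpenPartialHomeomorph (E n) (E n), e.source = U ∧ e.target = V ∧ EqOn e f U

/-- Quasiconformal mappings `f : U → V` (analytic definition): a homeomorphism which is ACL,
differentiable a.e. and satisfies `Λⁿ / C ≤ |J| ≤ C λⁿ` a.e. for some constant `C`. -/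
structure IsQuasiconformal {n : ℕ} (f : E n → E n) (U V : Set (E n)) : Prop where
  homeo : IsHomeoOn f U V
  acl : IsACL f U
  ae_differentiable : ∀ᵐ x ∂(volume.restrict U), DifferentiableAt ℝ f x
  bounded_dilatation : ∃ C : ℝ, 1 ≤ C ∧ ∀ᵐ x ∂(volume.restrict U),
    maxStretch (fderiv ℝ f x) ^ n / C ≤ |(fderiv ℝ f x).det| ∧
      |(fderiv ℝ f x).det| ≤ C * minStretch (fderiv ℝ f x) ^ n

/-- A quasiconformal mapping `f : U → V` is `K`-quasiconformal if for a.e. `x ∈ U` one has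
`J(x, f) ≠ 0` and the linear dilatation `H(f'(x)) = Λ / λ` is at most `K`. -/
def IsKQuasiconformal {n : ℕ} (K : ℝ) (f : E n → E n) (U V : Set (E n)) : Prop :=
  IsQuasiconformal f U V ∧ ∀ᵐ x ∂(volume.restrict U), (fderiv ℝ f x).det ≠ 0 ∧
    maxStretch (fderiv ℝ f x) / minStretch (fderiv ℝ f x) ≤ K

/-- The quasiconformality constant of `f`: the least `K` for which `f` is `K`-quasiconformal. -/
noncomputable def qcConstant {n : ℕ} (f : E n → E n) (U V : Set (E n)) : ℝ :=
  sInf {K : ℝ | IsKQuasiconformal K f U V}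

/-! ### Planar mappings -/

/-- The derivative `f_z = (f_x - i f_y) / 2`. -/
noncomputable def dz (f : ℂ → ℂ) (z : ℂ) : ℂ :=
  (fderiv ℝ f z 1 - Complex.I * fderiv ℝ f z Complex.I) / 2

/-- The derivative `f_z̄ = (f_x + i f_y) / 2`. -/
noncomputable def dzbar (f : ℂ → ℂ) (z : ℂ) : ℂ :=
  (fderiv ℝ f z 1 + Complex.I * fderiv ℝ f z Complex.I) / 2

/-- The complex dilatation `μ_f = f_z̄ / f_z`. -/
noncomputable def complexDilatation (f : ℂ → ℂ) (z : ℂ) : ℂ := dzbar f z / dz f z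

/-- The isometry `ℂ ≅ ℝ²`, `x + i y ↦ (x, y)`. -/
noncomputable def complexToPlane : ℂ ≃ₗᵢ[ℝ] E 2 := Complex.orthonormalBasisOneI.repr

/-- A mapping of the plane written in the complex coordinate. -/
noncomputable def complexForm (f : E 2 → E 2) (z : ℂ) : ℂ :=
  complexToPlane.symm (f (complexToPlane z))

/-- `k`-quasiconformality of a planar quasiconformal mapping: `|μ| ≤ k` a.e., where `μ` is the
complex dilatation of `f` where `f` preserves the orientation, and the complex dilatation of the
complex conjugate of `f` where `f` reverses it. -/
def IsSmallKQuasiconformal (k : ℝ) (f : E 2 → E 2) (U V : Set (E 2)) : Prop :=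
  IsQuasiconformal f U V ∧ ∀ᵐ x ∂(volume.restrict U), (fderiv ℝ f x).det ≠ 0 ∧
    (0 < (fderiv ℝ f x).det →
      ‖complexDilatation (complexForm f) (complexToPlane.symm x)‖ ≤ k) ∧
    ((fderiv ℝ f x).det < 0 →
      ‖complexDilatation (fun z => star (complexForm f z)) (complexToPlane.symm x)‖ ≤ k)

/-! ### Smooth convergence to a sphere -/

/-- For `t ∈ [0, 1]` let `D t` be strictly starlike with some tangent condition. The surfaces
`∂D t` converge smoothly to the sphere `Sⁿ⁻¹(r)` as `t → 0` if the essential supremum over the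
unit sphere of `|φ_t'(x) - r I|` tends to `0`. -/
def SmoothlyConvergesToSphere {n : ℕ} (D : ℝ → Set (E n)) (r : ℝ) : Prop :=
  (∀ t ∈ Icc (0 : ℝ) 1, IsStrictlyStarlike (D t) ∧ ∃ α, TangentCondition (D t) α) ∧
  Tendsto (fun t : ℝ =>
      essSup (fun x : Metric.sphere (0 : E n) 1 =>
        ‖fderiv ℝ (radialExtension (frontier (D t))) (x : E n)
          - r • ContinuousLinearMap.id ℝ (E n)‖ₑ) (volume : Measure (E n)).toSphere)
    (𝓝[>] 0) (𝓝 0)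

end QuasiInv

namespace QuasiInv

/-! ### The radial function of a strictly starlike domain -/

variable {n : ℕ} {D : Set (E n)} {M : Set (E n)}

/-! Write `ρ` for the radial function `radius (frontier D)`, which is constant on rays. Where `ρ` is
differentiable, the quasi-inversion has derivative `h ↦ c (h + ℓ(h) x)` with `c = ρ² / |x|²` and `ℓ
= 2 dρ / ρ - 2 ⟨x, ·⟩ / |x|²`. Since `dρ(x) = 0`, one has `ℓ(x) = -2`: the bracket is an oblique
reflection, of determinant `-1` and equal to its own inverse. Its least stretching is therefore the
reciprocal of its greatest, and only an upper bound is needed.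

The tangent condition supplies that bound. Differentiating a curve on the surface gives `|dρ(v)| |x|
≤ cot α · ρ |v|` for `v ⊥ x` (`abs_fderiv_radius_le`). Up to sign the reflection is thus a planar
shear of size at most `2 cot α`, and its norm is at most the `σ ≥ 1` with `σ - 1/σ = 2 cot α`, that
is `σ = cot (α/2)` (`sq_shear_le`, `norm_shear_bounds`). The ratio of the stretchings is at most
`σ²`. In the plane the same data give `|μ|² = τ² / (4 + τ²)` with `|τ| ≤ 2 cot α`, whence `|μ| ≤ cos
α`.

Regularity also comes from the tangent condition: it makes `ρ` pointwise Lipschitz with a locally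
uniform constant, hence locally Lipschitz, so Rademacher's theorem and absolute continuity on lines
apply.

For the convergence statement, a small essential supremum makes `dρ` small almost everywhere.
Integration along almost every parallel segment turns this into a small Lipschitz constant
(`abs_sub_le_of_ae_norm_fderiv_le`), which forces every angle close to `π/2`. The least constants
are then squeezed between `1` and `cot² (α/2)`. -/

theorem IsStrictlyStarlike.zero_notMem_frontier (hD : IsStrictlyStarlike D) :
    (0 : E n) ∉ frontier D := by
  rw [hD.isOpen.frontier_eq]
  exact fun h => h.2 hD.zero_mem

theorem IsStrictlyStarlike.isCompact_frontier (hD : IsStrictlyStarlike D) :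
    IsCompact (frontier D) :=
  Metric.isCompact_of_isClosed_isBounded isClosed_frontier
    (hD.isBounded.closure.subset frontier_subset_closure)

theorem ray_smul {x : E n} {c : ℝ} (hc : 0 < c) : ray (c • x) = ray x := by
  ext y
  constructor
  · rintro ⟨t, ht, rfl⟩
    exact ⟨t * c, by positivity, by rw [smul_smul]⟩
  · rintro ⟨t, ht, rfl⟩
    exact ⟨t / c, by positivity, by rw [smul_smul, div_mul_cancel₀ _ hc.ne']⟩

theorem radius_smul {x : E n} {c : ℝ} (hc : 0 < c) : radius M (c • x) = radius M x := by
  simp only [radius, ray_smul hc]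

/-- Uniqueness of the boundary point on a ray makes the infimum in `radius` one over a singleton. -/
theorem radius_spec (hD : IsStrictlyStarlike D) {x : E n} (hx : x ≠ 0) :
    0 < radius (frontier D) x ∧
      ray x ∩ frontier D = {(radius (frontier D) x / ‖x‖) • x} := by
  obtain ⟨w, hw, huniq⟩ := hD.existsUnique x hx
  have hs : ray x ∩ frontier D = {w} := by
    ext y
    exact ⟨fun hy => huniq y hy, fun hy => by rw [mem_singleton_iff.1 hy]; exact hw⟩
  have hr : radius (frontier D) x = ‖w‖ := by simp [radius, hs]
  have hx' := norm_pos_iff.2 hx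
  obtain ⟨⟨t, ht, rfl⟩, hwM⟩ := hw
  rw [hs, hr, norm_smul, Real.norm_of_nonneg ht.le, mul_div_cancel_right₀ _ hx'.ne']
  exact ⟨by positivity, rfl⟩

theorem radius_pos (hD : IsStrictlyStarlike D) {x : E n} (hx : x ≠ 0) :
    0 < radius (frontier D) x := (radius_spec hD hx).1

theorem radius_smul_mem_frontier (hD : IsStrictlyStarlike D) {x : E n} (hx : x ≠ 0) :
    (radius (frontier D) x / ‖x‖) • x ∈ frontier D := by
  have h : (radius (frontier D) x / ‖x‖) • x ∈ ray x ∩ frontier D := by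
    rw [(radius_spec hD hx).2]; rfl
  exact h.2

theorem radius_of_mem_frontier (hD : IsStrictlyStarlike D) {x : E n} (hx : x ∈ frontier D) :
    radius (frontier D) x = ‖x‖ := by
  have hx0 : x ≠ 0 := fun h => hD.zero_notMem_frontier (h ▸ hx)
  have h : x ∈ ray x ∩ frontier D := ⟨⟨1, one_pos, by simp⟩, hx⟩
  rw [(radius_spec hD hx0).2, mem_singleton_iff] at h
  have := congrArg norm h
  rw [norm_smul, Real.norm_of_nonneg (by have := radius_pos hD hx0; positivity),
    div_mul_cancel₀ _ (norm_ne_zero_iff.2 hx0)] at this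
  exact this.symm

/-- The radial projection of the surface onto the sphere is a continuous bijection from a compact
space to a Hausdorff one, hence a homeomorphism; `radius` is the norm of its inverse after
normalization. -/
theorem continuousOn_radius (hD : IsStrictlyStarlike D) :
    ContinuousOn (radius (frontier D)) {0}ᶜ := by
  set M := frontier D with hM
  have h0 : ∀ w : M, (w : E n) ≠ 0 := fun w h => hD.zero_notMem_frontier (h ▸ w.2)
  have hunit : ∀ x : E n, x ≠ 0 → ‖x‖⁻¹ • x ∈ Metric.sphere (0 : E n) 1 := fun x hx => by
    simp [norm_smul, inv_mul_cancel₀ (norm_ne_zero_iff.2 hx)]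
  let p : M → Metric.sphere (0 : E n) 1 := fun w => ⟨‖(w : E n)‖⁻¹ • w, hunit _ (h0 w)⟩
  have hpr : ∀ w : M, radius M (p w : E n) = ‖(w : E n)‖ := fun w => by
    rw [radius_smul (inv_pos.2 (norm_pos_iff.2 (h0 w))), radius_of_mem_frontier hD w.2]
  have hp : Continuous p := by
    refine Continuous.subtype_mk ?_ _
    exact (continuous_subtype_val.norm.inv₀ fun w => norm_ne_zero_iff.2 (h0 w)).smul
      continuous_subtype_val
  have hbij : Function.Bijective p := by
    constructor
    · intro v w hvw
      have h1 : ‖(v : E n)‖ = ‖(w : E n)‖ := by rw [← hpr, ← hpr, hvw]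
      have h2 : ‖(v : E n)‖⁻¹ • (v : E n) = ‖(w : E n)‖⁻¹ • (w : E n) := congrArg Subtype.val hvw
      rw [h1] at h2
      exact Subtype.ext (smul_right_injective _ (inv_ne_zero (norm_ne_zero_iff.2 (h0 w))) h2)
    · intro s
      have hs1 : ‖(s : E n)‖ = 1 := by simp
      have hs : (s : E n) ≠ 0 := by
        rw [← norm_ne_zero_iff, hs1]; exact one_ne_zero
      have hr := radius_pos hD hs
      refine ⟨⟨_, radius_smul_mem_frontier hD hs⟩, Subtype.ext ?_⟩
      simp only [p, hs1, div_one, norm_smul, Real.norm_of_nonneg hr.le, mul_one, smul_smul]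
      rw [inv_mul_cancel₀ hr.ne', one_smul]
  have : CompactSpace M := isCompact_iff_compactSpace.1 hD.isCompact_frontier
  let e : M ≃ₜ Metric.sphere (0 : E n) 1 :=
    Continuous.homeoOfEquivCompactToT2 (f := Equiv.ofBijective p hbij) hp
  have hre : ∀ s : Metric.sphere (0 : E n) 1, radius M (s : E n) = ‖(e.symm s : E n)‖ := fun s => by
    rw [← hpr (e.symm s)]
    exact congrArg (fun t : Metric.sphere (0 : E n) 1 => radius M t) (e.apply_symm_apply s).symm
  rw [continuousOn_iff_continuous_domRestrict]
  have hx : ∀ x : ({0}ᶜ : Set (E n)), (x : E n) ≠ 0 := fun x => x.2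
  have : ({0}ᶜ : Set (E n)).domRestrict (radius M) =
      fun x : ({0}ᶜ : Set (E n)) => ‖(e.symm ⟨‖(x : E n)‖⁻¹ • x, hunit _ (hx x)⟩ : E n)‖ := by
    ext x
    rw [← hre, radius_smul (inv_pos.2 (norm_pos_iff.2 (hx x))), domRestrict_apply]
  rw [this]
  refine (continuous_subtype_val.comp (e.symm.continuous.comp ?_)).norm
  refine Continuous.subtype_mk ?_ _
  exact (continuous_subtype_val.norm.inv₀ fun x => norm_ne_zero_iff.2 (hx x)).smul
    continuous_subtype_val

theorem exists_radius_le (hD : IsStrictlyStarlike D) :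
    ∃ R : ℝ, 0 < R ∧ ∀ x : E n, x ≠ 0 → radius (frontier D) x ≤ R := by
  obtain ⟨R, hR0, hR⟩ := hD.isCompact_frontier.isBounded.exists_pos_norm_le
  refine ⟨R, hR0, fun x hx => ?_⟩
  have := hR _ (radius_smul_mem_frontier hD hx)
  rwa [norm_smul, Real.norm_of_nonneg (by have := radius_pos hD hx; positivity),
    div_mul_cancel₀ _ (norm_ne_zero_iff.2 hx)] at this

theorem exists_le_radius (hD : IsStrictlyStarlike D) :
    ∃ R : ℝ, 0 < R ∧ ∀ x : E n, x ≠ 0 → R ≤ radius (frontier D) x := by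
  obtain ⟨R, hR0, hR⟩ := Metric.isOpen_iff.1 hD.isOpen 0 hD.zero_mem
  refine ⟨R, hR0, fun x hx => ?_⟩
  by_contra! h
  have h1 := radius_smul_mem_frontier hD hx
  have h2 : (radius (frontier D) x / ‖x‖) • x ∉ D := by
    exact fun h => (disjoint_frontier_iff_isOpen.2 hD.isOpen).le_bot ⟨h1, h⟩
  refine h2 (hR ?_)
  rwa [mem_ball_zero_iff, norm_smul, Real.norm_of_nonneg (by have := radius_pos hD hx; positivity),
    div_mul_cancel₀ _ (norm_ne_zero_iff.2 hx)]

/-! ### Angles -/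

theorem acuteAngle_nonneg (z x : E n) : 0 ≤ acuteAngle z x :=
  le_min (InnerProductGeometry.angle_nonneg _ _)
    (sub_nonneg.2 (InnerProductGeometry.angle_le_pi _ _))

theorem acuteAngle_le (z x : E n) : acuteAngle z x ≤ Real.pi / 2 := by
  unfold acuteAngle
  rcases le_total (InnerProductGeometry.angle (z - x) x) (Real.pi / 2) with h | h
  · exact (min_le_left _ _).trans h
  · exact (min_le_right _ _).trans (by linarith)

/-- Bounding both the angle and its supplement below by `β` amounts to `|cos| ≤ cos β`. The
resulting inequality passes to limits and stays true for `z = x`. -/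
theorem abs_inner_le_of_le_acuteAngle {z x : E n} {β : ℝ} (hβ : 0 ≤ β)
    (h : β ≤ acuteAngle z x) :
    |inner ℝ (z - x) x| ≤ Real.cos β * (‖z - x‖ * ‖x‖) := by
  obtain ⟨h1, h2⟩ := le_min_iff.1 h
  rw [← InnerProductGeometry.cos_angle_mul_norm_mul_norm, abs_mul,
    abs_of_nonneg (a := ‖z - x‖ * ‖x‖) (by positivity)]
  gcongr
  rw [abs_le]
  constructor
  · rw [← Real.cos_pi_sub]
    exact Real.cos_le_cos_of_nonneg_of_le_pi (InnerProductGeometry.angle_nonneg _ _)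
      (by linarith) (by linarith)
  · exact Real.cos_le_cos_of_nonneg_of_le_pi hβ (InnerProductGeometry.angle_le_pi _ _) h1

theorem le_acuteAngle_of_abs_inner_le {z x : E n} {β : ℝ} (hβ' : β ≤ Real.pi)
    (hzx : z ≠ x) (hx : x ≠ 0)
    (h : |inner ℝ (z - x) x| ≤ Real.cos β * (‖z - x‖ * ‖x‖)) : β ≤ acuteAngle z x := by
  have hp : 0 < ‖z - x‖ * ‖x‖ := mul_pos (norm_pos_iff.2 (sub_ne_zero.2 hzx)) (norm_pos_iff.2 hx)
  rw [← InnerProductGeometry.cos_angle_mul_norm_mul_norm, abs_mul,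
    abs_of_nonneg hp.le, mul_le_mul_iff_left₀ hp, abs_le] at h
  have ha := InnerProductGeometry.angle_nonneg (z - x) x
  have ha' := InnerProductGeometry.angle_le_pi (z - x) x
  refine le_min ?_ ?_
  · by_contra! h'
    exact (Real.cos_lt_cos_of_nonneg_of_le_pi ha hβ' h').not_ge h.2
  · by_contra! h'
    have := Real.cos_lt_cos_of_nonneg_of_le_pi (by linarith) hβ' h'
    rw [Real.cos_pi_sub] at this
    linarith [h.1]

theorem eventually_abs_inner_le {x : E n} {α β : ℝ} (hα : α ≤ angleAt M x)
    (hβ : 0 ≤ β) (hβα : β < α) :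
    ∀ᶠ z in 𝓝[M \ {x}] x, |inner ℝ (z - x) x| ≤ Real.cos β * (‖z - x‖ * ‖x‖) := by
  have hb : IsBoundedUnder (· ≥ ·) (𝓝[M \ {x}] x) (fun z => acuteAngle z x) :=
    isBoundedUnder_of ⟨0, fun z => acuteAngle_nonneg z x⟩
  filter_upwards [eventually_lt_of_lt_liminf (hβα.trans_le hα) hb] with z hz
  exact abs_inner_le_of_le_acuteAngle hβ hz.le

/-- Along the trivial filter the real `liminf` is the supremum of all reals, which has the default
value `0`; a positive angle thus excludes isolated points. -/
theorem neBot_of_angleAt_pos {x : E n} (h : 0 < angleAt M x) : (𝓝[M \ {x}] x).NeBot := by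
  rw [neBot_iff]
  intro hbot
  rw [angleAt, hbot] at h
  simp [liminf_eq] at h

theorem angleAt_le {x : E n} (h : 0 < angleAt M x) : angleAt M x ≤ Real.pi / 2 := by
  have := neBot_of_angleAt_pos h
  exact liminf_le_of_frequently_le (Frequently.of_forall fun z => acuteAngle_le z x)
    (isBoundedUnder_of ⟨0, fun z => acuteAngle_nonneg z x⟩)

theorem le_angleAt {x : E n} [(𝓝[M \ {x}] x).NeBot] {β : ℝ}
    (h : ∀ᶠ z in 𝓝[M \ {x}] x, β ≤ acuteAngle z x) : β ≤ angleAt M x :=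
  le_liminf_of_le (isBoundedUnder_of ⟨Real.pi / 2, fun z => acuteAngle_le z x⟩).isCoboundedUnder_ge
    h

/-! ### Lipschitz continuity and differentiability of the radial function -/

/-- A function which is pointwise Lipschitz, with the same constant, at every point of a convex
set is Lipschitz there. -/
theorem _root_.Convex.norm_sub_le_of_eventually_norm_sub_le {F G : Type*}
    [NormedAddCommGroup F] [NormedSpace ℝ F] [NormedAddCommGroup G] {s : Set F} (hs : Convex ℝ s)
    {f : F → G} {C : ℝ}
    (h : ∀ x ∈ s, ∀ᶠ y in 𝓝[s] x, ‖f y - f x‖ ≤ C * ‖y - x‖) {x y : F} (hx : x ∈ s)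
    (hy : y ∈ s) : ‖f y - f x‖ ≤ C * ‖y - x‖ := by
  set p : ℝ → F := ⇑(AffineMap.lineMap (k := ℝ) x y) with hp
  have hps : ∀ t ∈ Icc (0 : ℝ) 1, p t ∈ s := fun t ht => hs.lineMap_mem hx hy ht
  have hpc : Continuous p := AffineMap.lineMap_continuous
  have hpd : ∀ t u, ‖p u - p t‖ = |u - t| * ‖y - x‖ := fun t u => by
    rw [← dist_eq_norm, hp, dist_lineMap_lineMap, Real.dist_eq, dist_eq_norm, norm_sub_rev x y]
  have key : ∀ t ∈ Icc (0 : ℝ) 1, ∀ᶠ u in 𝓝[Icc 0 1] t,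
      ‖f (p u) - f (p t)‖ ≤ C * (|u - t| * ‖y - x‖) := fun t ht => by
    have ht' : Tendsto p (𝓝[Icc 0 1] t) (𝓝[s] (p t)) :=
      tendsto_nhdsWithin_iff.2 ⟨hpc.continuousAt.tendsto.mono_left nhdsWithin_le_nhds,
        eventually_mem_nhdsWithin.mono hps⟩
    simpa only [hpd] using ht'.eventually (h _ (hps t ht))
  have hcont : ContinuousOn (fun t => f (p t) - f x) (Icc 0 1) := by
    intro t ht
    rw [ContinuousWithinAt, tendsto_iff_norm_sub_tendsto_zero]
    have hlim : Tendsto (fun u => C * (|u - t| * ‖y - x‖)) (𝓝[Icc 0 1] t) (𝓝 0) := by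
      have : Continuous fun u => C * (|u - t| * ‖y - x‖) := by fun_prop
      simpa using this.continuousAt.tendsto.mono_left (nhdsWithin_le_nhds (a := t))
    refine squeeze_zero' (Eventually.of_forall fun _ => norm_nonneg _) ?_ hlim
    filter_upwards [key t ht] with u hu
    rwa [sub_sub_sub_cancel_right]
  have hB : ∀ t : ℝ, HasDerivAt (fun t => C * ‖y - x‖ * t) (C * ‖y - x‖) t := fun t => by
    simpa using (hasDerivAt_id t).const_mul (C * ‖y - x‖)
  -- Mean value inequality for Dini derivatives: the right slopes of `t ↦ ‖f (p t) - f x‖` are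
  -- eventually below every `r > C * ‖y - x‖`.
  have := image_le_of_liminf_slope_right_le_deriv_boundary
    (f := fun t => ‖f (p t) - f x‖) (B := fun t => C * ‖y - x‖ * t) (B' := fun _ => C * ‖y - x‖)
    (a := 0) (b := 1) hcont.norm (by simp [hp])
    (fun t _ => (hB t).continuousAt.continuousWithinAt) (fun t _ => (hB t).hasDerivWithinAt)
    (fun t ht r hr => by
      refine Eventually.frequently ?_
      have h0 : Icc (0 : ℝ) 1 ∈ 𝓝[>] t :=
        mem_of_superset (Ioc_mem_nhdsGT ht.2) fun u hu => ⟨ht.1.trans hu.1.le, hu.2⟩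
      have h1 : ∀ᶠ u in 𝓝[>] t, ‖f (p u) - f (p t)‖ ≤ C * (|u - t| * ‖y - x‖) :=
        (key t ⟨ht.1, ht.2.le⟩).filter_mono (nhdsWithin_le_of_mem h0)
      filter_upwards [h1, self_mem_nhdsWithin] with u hu htu
      have htu' : 0 < u - t := sub_pos.2 htu
      rw [slope_def_field, div_lt_iff₀ htu']
      rw [abs_of_pos htu'] at hu
      have h2 : ‖f (p u) - f x‖ ≤ ‖f (p u) - f (p t)‖ + ‖f (p t) - f x‖ := by
        simpa using norm_add_le (f (p u) - f (p t)) (f (p t) - f x)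
      have h3 := mul_lt_mul_of_pos_right hr htu'
      linarith)
    (right_mem_Icc.2 zero_le_one)
  simpa [hp] using this

theorem norm_inv_smul_sub_le {F : Type*} [NormedAddCommGroup F] [NormedSpace ℝ F] {x y : F}
    (hx : x ≠ 0) (hy : y ≠ 0) : ‖‖y‖⁻¹ • y - ‖x‖⁻¹ • x‖ ≤ 2 * (‖y - x‖ / ‖x‖) := by
  have hx' := norm_pos_iff.2 hx
  have hy' := norm_pos_iff.2 hy
  have h1 : ‖y‖⁻¹ • y - ‖x‖⁻¹ • x = ‖x‖⁻¹ • (y - x) + (‖y‖⁻¹ - ‖x‖⁻¹) • y := by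
    rw [smul_sub, sub_smul]; abel
  have h2 : ‖(‖y‖⁻¹ - ‖x‖⁻¹) • y‖ = |‖x‖ - ‖y‖| / ‖x‖ := by
    rw [norm_smul, Real.norm_eq_abs, ← abs_of_pos hy', ← abs_mul, abs_of_pos hy',
      ← abs_of_pos hx', ← abs_div, abs_of_pos hx']
    congr 1
    field_simp
  rw [h1]
  refine (norm_add_le _ _).trans ?_
  rw [h2, norm_smul, norm_inv, norm_norm, two_mul, ← div_eq_inv_mul]
  gcongr
  rw [norm_sub_rev y x]
  exact abs_norm_sub_norm_le x y

/-- Split `p e' - q e = p (e' - e) + (p - q) e`. The inner product with `e` recovers `p - q` up to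
`p ‖e' - e‖`, while the norm is at most `p ‖e' - e‖ + |p - q|`; since `c < 1`, the term `c |p - q|`
can be absorbed. -/
theorem abs_sub_le_of_abs_inner_le {e e' : E n} {p q c : ℝ} (he : ‖e‖ = 1)
    (hp : 0 < p) (hq : 0 < q) (hc0 : 0 ≤ c) (hc : c < 1)
    (h : |inner ℝ (p • e' - q • e) (q • e)| ≤ c * (‖p • e' - q • e‖ * ‖q • e‖)) :
    |p - q| ≤ 2 / (1 - c) * p * ‖e' - e‖ := by
  have hz : p • e' - q • e = p • (e' - e) + (p - q) • e := by
    rw [smul_sub, sub_smul]; abel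
  have h1 : ‖p • e' - q • e‖ ≤ p * ‖e' - e‖ + |p - q| := by
    rw [hz]
    refine (norm_add_le _ _).trans ?_
    rw [norm_smul, norm_smul, he, Real.norm_of_nonneg hp.le, mul_one, Real.norm_eq_abs]
  have h2 : inner ℝ (p • e' - q • e) (q • e) = q * (p * inner ℝ (e' - e) e + (p - q)) := by
    rw [hz, inner_smul_right, inner_add_left, real_inner_smul_left, real_inner_smul_left,
      real_inner_self_eq_norm_sq, he]
    ring
  have h3 : |inner ℝ (e' - e) e| ≤ ‖e' - e‖ := by
    simpa [he] using abs_real_inner_le_norm (e' - e) e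
  rw [h2, norm_smul, he, abs_mul, Real.norm_of_nonneg hq.le, abs_of_pos hq, mul_one, mul_comm q,
    ← mul_assoc, mul_le_mul_iff_left₀ hq] at h
  have h4 : |p - q| ≤ |p * inner ℝ (e' - e) e + (p - q)| + p * |inner ℝ (e' - e) e| := by
    rw [← abs_of_pos hp, ← abs_mul, abs_of_pos hp]
    have := abs_sub (p * inner ℝ (e' - e) e + (p - q)) (p * inner ℝ (e' - e) e)
    rwa [add_sub_cancel_left] at this
  have hc1 : 0 < 1 - c := by linarith
  rw [mul_assoc, div_mul_eq_mul_div, le_div_iff₀ hc1]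
  have h5 := mul_le_mul_of_nonneg_left h3 hp.le
  have h6 := mul_le_mul_of_nonneg_left h1 hc0
  have h7 : c * (p * ‖e' - e‖) ≤ 1 * (p * ‖e' - e‖) := by gcongr
  nlinarith

theorem smul_normalize_eq (x : E n) (r : ℝ) : (r / ‖x‖) • x = r • (‖x‖⁻¹ • x) := by
  rw [smul_smul, div_eq_mul_inv]

theorem tendsto_radius_smul (hD : IsStrictlyStarlike D) {x : E n} (hx : x ≠ 0) :
    Tendsto (fun y => (radius (frontier D) y / ‖y‖) • y) (𝓝 x)
      (𝓝 ((radius (frontier D) x / ‖x‖) • x)) := by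
  have h := (continuousOn_radius hD).continuousAt (isOpen_compl_singleton.mem_nhds hx)
  exact (h.div continuous_norm.continuousAt (norm_ne_zero_iff.2 hx)).smul continuousAt_id

theorem eventually_abs_inner_radius_le (hD : IsStrictlyStarlike D) {α β : ℝ}
    (hα : TangentCondition D α) (hβ : 0 ≤ β) (hβα : β < α) {x : E n} (hx : x ≠ 0) :
    ∀ᶠ y in 𝓝 x, |inner ℝ ((radius (frontier D) y / ‖y‖) • y - (radius (frontier D) x / ‖x‖) • x)
        ((radius (frontier D) x / ‖x‖) • x)| ≤
      Real.cos β * (‖(radius (frontier D) y / ‖y‖) • y - (radius (frontier D) x / ‖x‖) • x‖ *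
        ‖(radius (frontier D) x / ‖x‖) • x‖) := by
  have h := eventually_abs_inner_le (hα.2.2 _ (radius_smul_mem_frontier hD hx)) hβ hβα
  rw [eventually_nhdsWithin_iff] at h
  filter_upwards [(tendsto_radius_smul hD hx).eventually h, isOpen_ne.mem_nhds hx] with y hy hy0
  by_cases hxy : (radius (frontier D) y / ‖y‖) • y = (radius (frontier D) x / ‖x‖) • x
  · simp [hxy]
  · exact hy ⟨radius_smul_mem_frontier hD hy0, hxy⟩

theorem exists_eventually_abs_radius_sub_le (hD : IsStrictlyStarlike D) {α : ℝ}
    (hα : TangentCondition D α) :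
    ∃ C : ℝ, 0 < C ∧ ∀ x : E n, x ≠ 0 →
      ∀ᶠ y in 𝓝 x, |radius (frontier D) y - radius (frontier D) x| ≤ C / ‖x‖ * ‖y - x‖ := by
  obtain ⟨R, hR0, hR⟩ := exists_radius_le hD
  have hα0 := hα.1
  have hα2 := hα.2.1
  have hpi := Real.pi_pos
  have hc0 : 0 ≤ Real.cos (α / 2) := Real.cos_nonneg_of_mem_Icc ⟨by linarith, by linarith⟩
  have hc1 : Real.cos (α / 2) < 1 := by
    rw [← Real.cos_zero]
    exact Real.cos_lt_cos_of_nonneg_of_le_pi le_rfl (by linarith) (by linarith)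
  have hc2 : 0 < 1 - Real.cos (α / 2) := by linarith
  -- A liminf gives eventual bounds only for angles below `α`; here `α / 2` is used. The last factor
  -- `2` comes from normalizing vectors.
  refine ⟨2 / (1 - Real.cos (α / 2)) * R * 2, by positivity, fun x hx => ?_⟩
  filter_upwards [eventually_abs_inner_radius_le hD hα (β := α / 2) (by linarith) (by linarith) hx,
    isOpen_ne.mem_nhds hx] with y hy hy0
  have hx' := norm_pos_iff.2 hx
  rw [smul_normalize_eq, smul_normalize_eq] at hy
  refine (abs_sub_le_of_abs_inner_le (norm_smul_inv_norm hx) (radius_pos hD hy0)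
    (radius_pos hD hx) hc0 hc1 hy).trans ?_
  calc _ ≤ 2 / (1 - Real.cos (α / 2)) * R * (2 * (‖y - x‖ / ‖x‖)) := by
        have := hR y hy0
        gcongr
        exact norm_inv_smul_sub_le hx hy0
    _ = _ := by ring

theorem lipschitzOnWith_of_norm_sub_le {F G : Type*} [SeminormedAddCommGroup F]
    [SeminormedAddCommGroup G] {f : F → G} {s : Set F} {C : ℝ}
    (h : ∀ x ∈ s, ∀ y ∈ s, ‖f x - f y‖ ≤ C * ‖x - y‖) : LipschitzOnWith C.toNNReal f s :=
  LipschitzOnWith.of_dist_le' fun x hx y hy => by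
    simpa only [dist_eq_norm] using h x hx y hy

theorem half_norm_lt_of_mem_ball {x y : E n} (h : y ∈ Metric.ball x (‖x‖ / 2)) :
    ‖x‖ / 2 < ‖y‖ := by
  rw [mem_ball_iff_norm] at h
  have := norm_sub_norm_le x y
  rw [norm_sub_rev] at this
  linarith

/-- On the ball of radius `‖x‖ / 2` about `x` the pointwise constants `C / ‖w‖` are uniformly
bounded, and the ball is convex. -/
theorem locallyLipschitzOn_radius (hD : IsStrictlyStarlike D) {α : ℝ}
    (hα : TangentCondition D α) : LocallyLipschitzOn {0}ᶜ (radius (frontier D)) := by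
  obtain ⟨C, hC0, hC⟩ := exists_eventually_abs_radius_sub_le hD hα
  intro x hx
  have hx' : 0 < ‖x‖ := norm_pos_iff.2 hx
  refine ⟨(C / (‖x‖ / 2)).toNNReal, Metric.ball x (‖x‖ / 2),
    mem_nhdsWithin_of_mem_nhds (Metric.ball_mem_nhds _ (by positivity)),
    lipschitzOnWith_of_norm_sub_le fun y hy z hz => ?_⟩
  refine (convex_ball x (‖x‖ / 2)).norm_sub_le_of_eventually_norm_sub_le (fun w hw => ?_) hz hy
  have hw' := half_norm_lt_of_mem_ball hw
  filter_upwards [mem_nhdsWithin_of_mem_nhds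
    (hC w (norm_pos_iff.1 (lt_trans (by positivity) hw')))] with v hv
  refine hv.trans ?_
  gcongr

/-- Rademacher's theorem for locally Lipschitz maps. -/
theorem _root_.LocallyLipschitzOn.ae_differentiableAt {F G : Type*} [NormedAddCommGroup F]
    [NormedSpace ℝ F] [FiniteDimensional ℝ F] [MeasurableSpace F] [BorelSpace F]
    [NormedAddCommGroup G] [NormedSpace ℝ G] [FiniteDimensional ℝ G] {μ : Measure F}
    [μ.IsAddHaarMeasure] {f : F → G} {U : Set F} (hf : LocallyLipschitzOn U f) (hU : IsOpen U) :
    ∀ᵐ x ∂(μ.restrict U), DifferentiableAt ℝ f x := by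
  rw [ae_restrict_iff' hU.measurableSet, ae_iff]
  refine measure_null_of_locally_null _ fun x hx => ?_
  simp only [mem_ofPred_eq, Classical.not_imp] at hx
  obtain ⟨K, t, ht, hK⟩ := hf hx.1
  rw [hU.nhdsWithin_eq hx.1] at ht
  obtain ⟨V, hVt, hV, hxV⟩ := mem_nhds_iff.1 ht
  refine ⟨V ∩ {a | ¬(a ∈ U → DifferentiableAt ℝ f a)}, inter_comm _ _ ▸
    inter_mem_nhdsWithin _ (hV.mem_nhds hxV), ?_⟩
  have := (hK.mono hVt).ae_differentiableWithinAt_of_mem (μ := μ)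
  refine measure_mono_null (fun y hy => ?_) (ae_iff.1 this)
  simp only [mem_inter_iff, mem_ofPred_eq, Classical.not_imp] at hy ⊢
  exact ⟨hy.1, fun h => hy.2.2 (h.differentiableAt (hV.mem_nhds hy.1))⟩

theorem ae_differentiableAt_radius (hD : IsStrictlyStarlike D) {α : ℝ}
    (hα : TangentCondition D α) :
    ∀ᵐ x ∂(volume.restrict ({0}ᶜ : Set (E n))), DifferentiableAt ℝ (radius (frontier D)) x :=
  (locallyLipschitzOn_radius hD hα).ae_differentiableAt isOpen_compl_singleton

/-! ### The derivative of the radial function -/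

/-- Euler's relation for a function homogeneous of degree `0`. -/
theorem fderiv_radius_self {x : E n} (hd : DifferentiableAt ℝ (radius M) x) :
    fderiv ℝ (radius M) x x = 0 := by
  have h1 : HasDerivAt (fun s : ℝ => radius M (x + s • x)) (fderiv ℝ (radius M) x x) 0 :=
    hd.hasFDerivAt.hasLineDerivAt x
  have h2 : HasDerivAt (fun s : ℝ => radius M (x + s • x)) 0 0 := by
    refine (hasDerivAt_const (0 : ℝ) (radius M x)).congr_of_eventuallyEq ?_
    filter_upwards [isOpen_Ioi.mem_nhds (show (0 : ℝ) ∈ Ioi (-1) by simp)] with s hs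
    rw [show x + s • x = (1 + s) • x by rw [add_smul, one_smul],
      radius_smul (by linarith [mem_Ioi.1 hs])]
  exact h1.unique h2

theorem _root_.HasDerivAt.abs_inner_le {F : Type*} [NormedAddCommGroup F] [InnerProductSpace ℝ F]
    {γ : ℝ → F} {γ' w : F} {t c : ℝ} (hγ : HasDerivAt γ γ' t)
    (h : ∀ᶠ s in 𝓝 t, |inner ℝ (γ s - γ t) w| ≤ c * (‖γ s - γ t‖ * ‖w‖)) :
    |inner ℝ γ' w| ≤ c * (‖γ'‖ * ‖w‖) := by
  have hs := hasDerivAt_iff_tendsto_slope.1 hγ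
  -- The hypothesis holds only near `t`; the `if` replaces the left side by the right one elsewhere,
  -- so the comparison holds for every `s`.
  refine le_of_tendsto_of_tendsto' (b := 𝓝[≠] t)
    (f := fun s => if |inner ℝ (γ s - γ t) w| ≤ c * (‖γ s - γ t‖ * ‖w‖) then
      |inner ℝ (slope γ t s) w| else c * (‖slope γ t s‖ * ‖w‖))
    ?_ ((hs.norm.mul_const _).const_mul c) fun s => ?_
  · refine ((hs.inner tendsto_const_nhds).abs).congr' ?_
    filter_upwards [nhdsWithin_le_nhds h] with s hs
    rw [if_pos hs]
  · split_ifs with hle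
    · rw [slope_def_module, real_inner_smul_left, norm_smul, abs_mul, Real.norm_eq_abs, mul_assoc,
        mul_left_comm]
      gcongr
    · exact le_rfl

/-- The line `x + s v`, projected radially onto the surface, has velocity `(ρ/‖x‖) v + (L v/‖x‖) x`
at `s = 0`. Its two components are orthogonal, so the angle inequality for it, once squared, becomes
the claim. -/
theorem abs_fderiv_radius_le_aux (hD : IsStrictlyStarlike D) {α β : ℝ}
    (hα : TangentCondition D α) (hβ : 0 ≤ β) (hβα : β < α) {x : E n} (hx : x ≠ 0)
    (hd : DifferentiableAt ℝ (radius (frontier D)) x) {v : E n} (hv : inner ℝ x v = 0) :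
    Real.sin β * (|fderiv ℝ (radius (frontier D)) x v| * ‖x‖) ≤
      Real.cos β * (radius (frontier D) x * ‖v‖) := by
  set ρ := radius (frontier D) with hρ
  set L := fderiv ℝ ρ x with hL
  have hx' := norm_pos_iff.2 hx
  have hr : 0 < ρ x := radius_pos hD hx
  have h1 : HasDerivAt (fun s : ℝ => x + s • v) v 0 := by
    simpa using ((hasDerivAt_id (0 : ℝ)).smul_const v).const_add x
  -- The norm is stationary along `x + s v` because `v ⊥ x`.
  have hn : HasDerivAt (fun s : ℝ => ‖x + s • v‖) 0 0 := by
    have h2 : HasDerivAt (fun s : ℝ => ‖x + s • v‖ ^ 2) 0 0 := by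
      simpa [hv] using h1.norm_sq
    have h3 := h2.sqrt (by simpa using hx)
    simpa using h3
  have hρ1 : HasDerivAt (fun s : ℝ => ρ (x + s • v)) (L v) 0 := hd.hasFDerivAt.hasLineDerivAt v
  have hγ : HasDerivAt (fun s : ℝ => (ρ (x + s • v) / ‖x + s • v‖) • (x + s • v))
      ((ρ x / ‖x‖) • v + (L v / ‖x‖) • x) 0 := by
    refine ((hρ1.div hn (by simpa using hx)).smul h1).congr_deriv ?_
    simp only [Pi.div_apply, zero_smul, add_zero, mul_zero, sub_zero]
    rw [pow_two, mul_div_mul_right _ _ hx'.ne']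
  have hev : ∀ᶠ s : ℝ in 𝓝 0,
      |inner ℝ ((ρ (x + s • v) / ‖x + s • v‖) • (x + s • v) -
        (ρ (x + (0 : ℝ) • v) / ‖x + (0 : ℝ) • v‖) • (x + (0 : ℝ) • v)) ((ρ x / ‖x‖) • x)| ≤
      Real.cos β * (‖(ρ (x + s • v) / ‖x + s • v‖) • (x + s • v) -
        (ρ (x + (0 : ℝ) • v) / ‖x + (0 : ℝ) • v‖) • (x + (0 : ℝ) • v)‖ * ‖(ρ x / ‖x‖) • x‖) := by
    have ht : Tendsto (fun s : ℝ => x + s • v) (𝓝 0) (𝓝 x) := by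
      simpa using h1.continuousAt.tendsto
    simpa using ht.eventually (eventually_abs_inner_radius_le hD hα hβ hβα hx)
  have key := hγ.abs_inner_le hev
  have hin : inner ℝ ((ρ x / ‖x‖) • v + (L v / ‖x‖) • x) ((ρ x / ‖x‖) • x) = ρ x * L v := by
    rw [inner_add_left, real_inner_smul_left, real_inner_smul_left, real_inner_smul_right,
      real_inner_smul_right, real_inner_comm, hv, real_inner_self_eq_norm_sq]
    field_simp
    ring
  have hnx : ‖(ρ x / ‖x‖) • x‖ = ρ x := by
    rw [norm_smul, Real.norm_of_nonneg (by positivity), div_mul_cancel₀ _ hx'.ne']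
  have hnv : ‖(ρ x / ‖x‖) • v + (L v / ‖x‖) • x‖ ^ 2 = (ρ x * ‖v‖ / ‖x‖) ^ 2 + L v ^ 2 := by
    rw [norm_add_sq_real, real_inner_smul_left, real_inner_smul_right, real_inner_comm, hv,
      norm_smul, norm_smul, mul_pow, mul_pow, Real.norm_eq_abs, Real.norm_eq_abs, sq_abs, sq_abs]
    field_simp
    ring
  rw [hin, hnx, abs_mul, abs_of_pos hr, mul_comm (ρ x), ← mul_assoc,
    mul_le_mul_iff_left₀ hr] at key
  have hcos : 0 ≤ Real.cos β :=
    Real.cos_nonneg_of_mem_Icc ⟨by linarith [Real.pi_pos], by linarith [hα.2.1]⟩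
  have h5 := pow_le_pow_left₀ (abs_nonneg _) key 2
  rw [mul_pow, hnv, sq_abs] at h5
  refine abs_le_of_sq_le_sq' ?_ (by positivity) |>.2
  have h6 : (ρ x * ‖v‖ / ‖x‖) ^ 2 * ‖x‖ ^ 2 = (ρ x * ‖v‖) ^ 2 := by field_simp
  rw [mul_pow, mul_pow, sq_abs, mul_pow, ← h6]
  have h7 := Real.sin_sq_add_cos_sq β
  have h8 := mul_le_mul_of_nonneg_right h5 (sq_nonneg ‖x‖)
  rw [show Real.sin β ^ 2 = 1 - Real.cos β ^ 2 by linarith]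
  linarith

/-- Let `β` increase to `α`; both sides are continuous in `β`. -/
theorem abs_fderiv_radius_le (hD : IsStrictlyStarlike D) {α : ℝ}
    (hα : TangentCondition D α) {x : E n} (hx : x ≠ 0)
    (hd : DifferentiableAt ℝ (radius (frontier D)) x) {v : E n} (hv : inner ℝ x v = 0) :
    Real.sin α * (|fderiv ℝ (radius (frontier D)) x v| * ‖x‖) ≤
      Real.cos α * (radius (frontier D) x * ‖v‖) := by
  have h1 : Tendsto (fun β => Real.sin β * (|fderiv ℝ (radius (frontier D)) x v| * ‖x‖)) (𝓝[<] α)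
      (𝓝 (Real.sin α * (|fderiv ℝ (radius (frontier D)) x v| * ‖x‖))) :=
    (Continuous.tendsto (by fun_prop) α).mono_left nhdsWithin_le_nhds
  have h2 : Tendsto (fun β => Real.cos β * (radius (frontier D) x * ‖v‖)) (𝓝[<] α)
      (𝓝 (Real.cos α * (radius (frontier D) x * ‖v‖))) :=
    (Continuous.tendsto (by fun_prop) α).mono_left nhdsWithin_le_nhds
  refine le_of_tendsto_of_tendsto h1 h2 ?_
  filter_upwards [Ioo_mem_nhdsLT hα.1] with β hβ
  exact abs_fderiv_radius_le_aux hD hα hβ.1.le hβ.2 hx hd hv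

/-! ### The derivative of the quasi-inversion -/

/-- The functional `ℓ` for which `f'(x) h = (r_x² / |x|²) (h + ℓ(h) x)`. -/
noncomputable def quasiInversionFunctional (M : Set (E n)) (x : E n) : E n →L[ℝ] ℝ :=
  (2 / radius M x) • fderiv ℝ (radius M) x - (2 / ‖x‖ ^ 2) • innerSL ℝ x

theorem hasFDerivAt_quasiInversion {x : E n} (hx : x ≠ 0) (hr : radius M x ≠ 0)
    (hd : DifferentiableAt ℝ (radius M) x) :
    HasFDerivAt (quasiInversion M) ((radius M x ^ 2 / ‖x‖ ^ 2) •
      (ContinuousLinearMap.id ℝ (E n) + (quasiInversionFunctional M x).smulRight x)) x := by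
  have hx' := norm_ne_zero_iff.2 hx
  have h1 := hd.hasFDerivAt.pow 2
  have h2 := (hasStrictFDerivAt_norm_sq x).hasFDerivAt
  have h3 := ((hasDerivAt_inv (pow_ne_zero 2 hx')).comp_hasFDerivAt x h2)
  have h4 := (h1.mul h3).smul (hasFDerivAt_id x)
  refine h4.congr_fderiv ?_
  ext1 h
  simp [quasiInversionFunctional, smul_smul, smul_add]
  rw [div_eq_mul_inv]
  congr 2
  field_simp
  ring

/-- The bracket is a transvection, of determinant `1 + ℓ(x)`, and `ℓ(x) = -2` by Euler's relation.
-/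
theorem det_quasiInversionFunctional {x : E n} (hx : x ≠ 0)
    (hd : DifferentiableAt ℝ (radius M) x) (c : ℝ) :
    (c • (ContinuousLinearMap.id ℝ (E n) + (quasiInversionFunctional M x).smulRight x)).det =
      -c ^ n := by
  have h1 : ((c • (ContinuousLinearMap.id ℝ (E n) +
      (quasiInversionFunctional M x).smulRight x) : E n →L[ℝ] E n) : E n →ₗ[ℝ] E n) =
      c • LinearMap.transvection (quasiInversionFunctional M x : E n →ₗ[ℝ] ℝ) x := by
    ext h
    simp [LinearMap.transvection]
  have h2 : quasiInversionFunctional M x x = -2 := by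
    have := norm_ne_zero_iff.2 hx
    simp only [quasiInversionFunctional, sub_apply,
      smul_apply, fderiv_radius_self hd, innerSL_apply_apply,
      real_inner_self_eq_norm_sq, smul_eq_mul]
    field_simp
    ring
  rw [ContinuousLinearMap.det, h1, LinearMap.det_smul, LinearMap.transvection.det,
    finrank_euclideanSpace_fin, ContinuousLinearMap.coe_coe, h2]
  ring

/-! ### Norm of the planar shear and the half-angle -/

/-- The planar shear by `m = σ - 1/σ` has norm exactly `σ`. -/
theorem sq_shear_le {σ X K Z : ℝ} (hσ : 1 ≤ σ) (hZ : σ * |Z| ≤ (σ ^ 2 - 1) * K) :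
    (X - Z) ^ 2 + K ^ 2 ≤ σ ^ 2 * (X ^ 2 + K ^ 2) := by
  have hσ0 : 0 < σ := by linarith
  obtain ⟨m, hm⟩ : ∃ m, m = (σ ^ 2 - 1) / σ := ⟨_, rfl⟩
  have hm0 : 0 ≤ m := hm ▸ div_nonneg (by nlinarith) hσ0.le
  have hmσ : m * σ = σ ^ 2 - 1 := by rw [hm, div_mul_cancel₀ _ hσ0.ne']
  have hZ' : |Z| ≤ m * K := by
    rw [hm, div_mul_eq_mul_div, le_div_iff₀ hσ0]
    linarith
  have h1 : |X - Z| ≤ |X| + m * K := (abs_sub _ _).trans (by linarith)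
  have h2 : (X - Z) ^ 2 ≤ (|X| + m * K) ^ 2 := by
    rw [← sq_abs]
    exact pow_le_pow_left₀ (abs_nonneg _) h1 2
  -- This square is the whole gap between the two sides after the triangle inequality.
  have h3 : 0 ≤ m / σ * (σ * |X| - K) ^ 2 := by positivity
  have h4 : m / σ * (σ * |X| - K) ^ 2 =
      (σ ^ 2 - 1) * |X| ^ 2 - 2 * m * (|X| * K) + (σ ^ 2 - 1 - m ^ 2) * K ^ 2 := by
    rw [← hmσ, div_mul_eq_mul_div, div_eq_iff hσ0.ne']
    linear_combination (m * K ^ 2) * hmσ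
  rw [← sq_abs X]
  nlinarith

theorem one_le_cot_half {α : ℝ} (h0 : 0 < α) (h1 : α ≤ Real.pi / 2) : 1 ≤ Real.cot (α / 2) := by
  have hs : 0 < Real.sin (α / 2) :=
    Real.sin_pos_of_pos_of_lt_pi (by linarith) (by linarith)
  rw [Real.cot_eq_cos_div_sin, one_le_div hs, ← Real.sin_pi_div_two_sub]
  exact Real.sin_le_sin_of_le_of_le_pi_div_two (by linarith) (by linarith) (by linarith)

/-- Equivalent to `σ - 1/σ = 2 cot α` for `σ = cot (α/2)`; this is where the half-angle enters. -/
theorem sin_mul_cot_half_sq_sub_one {α : ℝ} (h0 : 0 < α) (h1 : α ≤ Real.pi / 2) :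
    Real.sin α * (Real.cot (α / 2) ^ 2 - 1) = 2 * Real.cos α * Real.cot (α / 2) := by
  have hs : 0 < Real.sin (α / 2) :=
    Real.sin_pos_of_pos_of_lt_pi (by linarith) (by linarith [Real.pi_pos])
  have e1 : Real.sin α = 2 * Real.sin (α / 2) * Real.cos (α / 2) := by
    rw [← Real.sin_two_mul, mul_div_cancel₀ _ two_ne_zero]
  have e2 : Real.cos α = Real.cos (α / 2) ^ 2 - Real.sin (α / 2) ^ 2 := by
    rw [← Real.cos_two_mul', mul_div_cancel₀ _ two_ne_zero]
  rw [e1, e2, Real.cot_eq_cos_div_sin]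
  field_simp

theorem cot_half_sq_quotient {α : ℝ} (h0 : 0 < α) (h1 : α ≤ Real.pi / 2) :
    (Real.cot (α / 2) ^ 2 - 1) / (Real.cot (α / 2) ^ 2 + 1) = Real.cos α := by
  have hs : 0 < Real.sin (α / 2) :=
    Real.sin_pos_of_pos_of_lt_pi (by linarith) (by linarith [Real.pi_pos])
  have e2 : Real.cos α = Real.cos (α / 2) ^ 2 - Real.sin (α / 2) ^ 2 := by
    rw [← Real.cos_two_mul', mul_div_cancel₀ _ two_ne_zero]
  rw [e2, Real.cot_eq_cos_div_sin, div_pow, div_sub_one (by positivity),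
    div_add_one (by positivity), div_div_div_cancel_right₀ (by positivity),
    Real.cos_sq_add_sin_sq, div_one]

/-- The bounds for the stretching of the shear `h ↦ h + ℓ(h) x`. -/
theorem norm_shear_bounds (hD : IsStrictlyStarlike D) {α : ℝ}
    (hα : TangentCondition D α) {x : E n} (hx : x ≠ 0)
    (hd : DifferentiableAt ℝ (radius (frontier D)) x) (h : E n) :
    ‖h + quasiInversionFunctional (frontier D) x h • x‖ ≤ Real.cot (α / 2) * ‖h‖ ∧
      ‖h‖ ≤ Real.cot (α / 2) * ‖h + quasiInversionFunctional (frontier D) x h • x‖ := by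
  have hx' := norm_pos_iff.2 hx
  have hr := radius_pos hD hx
  have hσ := one_le_cot_half hα.1 hα.2.1
  set ρ := radius (frontier D) with hρ
  set L := fderiv ℝ ρ x with hL
  set σ := Real.cot (α / 2)
  have hsin : 0 < Real.sin α :=
    Real.sin_pos_of_pos_of_lt_pi hα.1 (by linarith [Real.pi_pos, hα.2.1])
  obtain ⟨a, ha⟩ : ∃ a, a = inner ℝ x h / ‖x‖ ^ 2 := ⟨_, rfl⟩
  obtain ⟨k, hk⟩ : ∃ k, k = h - a • x := ⟨_, rfl⟩
  have hxk : inner ℝ x k = 0 := by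
    rw [hk, inner_sub_right, real_inner_smul_right, real_inner_self_eq_norm_sq, ha]
    field_simp
    ring
  have hh : h = a • x + k := by rw [hk]; abel
  have hLk : L h = L k := by
    rw [hh, map_add, map_smul, fderiv_radius_self hd, smul_zero, zero_add]
  -- In the splitting `h = a x + k` with `k ⊥ x`, the map fixes `k` and sends `a` to `2 L k / ρ -
  -- a`.
  have hf : h + quasiInversionFunctional (frontier D) x h • x = (2 * L k / ρ x - a) • x + k := by
    have : quasiInversionFunctional (frontier D) x h = 2 * L k / ρ x - 2 * a := by
      simp only [quasiInversionFunctional, sub_apply,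
        smul_apply, innerSL_apply_apply, smul_eq_mul]
      rw [← hρ, ← hL, hLk, ha]
      ring
    rw [this, hh]
    module
  have hpy : ∀ b : ℝ, ‖b • x + k‖ ^ 2 = (b * ‖x‖) ^ 2 + ‖k‖ ^ 2 := fun b => by
    rw [norm_add_sq_real, real_inner_smul_left, hxk, norm_smul, mul_pow, mul_pow,
      Real.norm_eq_abs, sq_abs]
    ring
  have hZ : σ * |2 * L k / ρ x * ‖x‖| ≤ (σ ^ 2 - 1) * ‖k‖ := by
    have h1 := abs_fderiv_radius_le hD hα hx hd hxk
    have h2 := sin_mul_cot_half_sq_sub_one hα.1 hα.2.1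
    rw [abs_mul, abs_div, abs_mul, abs_of_pos hr, abs_of_pos hx', abs_two]
    have h3 : σ * (2 * |L k| / ρ x * ‖x‖) = 2 * σ * (|L k| * ‖x‖) / ρ x := by ring
    rw [h3, div_le_iff₀ hr]
    refine le_of_mul_le_mul_left ?_ hsin
    have h4 := mul_le_mul_of_nonneg_left h1 (show 0 ≤ 2 * σ by linarith)
    calc _ = 2 * σ * (Real.sin α * (|L k| * ‖x‖)) := by ring
      _ ≤ _ := h4
      _ = Real.sin α * (σ ^ 2 - 1) * (ρ x * ‖k‖) := by rw [h2]; ring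
      _ = _ := by ring
  rw [hf]
  have hσ0 : 0 ≤ σ := by linarith
  constructor
  · refine le_of_sq_le_sq ?_ (by positivity)
    rw [mul_pow, hh, hpy, hpy]
    have := sq_shear_le (X := a * ‖x‖) hσ hZ
    linarith
  -- The map is an involution, so the lower bound is the same estimate applied to the image vector.
  · refine le_of_sq_le_sq ?_ (by positivity)
    rw [mul_pow, hh, hpy, hpy]
    have := sq_shear_le (X := (2 * L k / ρ x - a) * ‖x‖) hσ hZ
    linarith

/-! ### Extremal stretchings of linear maps -/

theorem maxStretch_le {A : E n →L[ℝ] E n} {C : ℝ} (hC : 0 ≤ C) (h : ∀ v, ‖A v‖ ≤ C * ‖v‖) :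
    maxStretch A ≤ C := by
  refine Real.sSup_le ?_ hC
  rintro _ ⟨v, hv, rfl⟩
  simpa [mem_sphere_zero_iff_norm.1 hv] using h v

theorem sphere_nonempty (hn : 0 < n) : (Metric.sphere (0 : E n) 1).Nonempty := by
  have : Nonempty (Fin n) := ⟨⟨0, hn⟩⟩
  exact NormedSpace.sphere_nonempty.2 zero_le_one

theorem le_minStretch (hn : 0 < n) {A : E n →L[ℝ] E n} {C : ℝ} (h : ∀ v, C * ‖v‖ ≤ ‖A v‖) :
    C ≤ minStretch A := by
  refine le_csInf ((sphere_nonempty hn).image _) ?_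
  rintro _ ⟨v, hv, rfl⟩
  simpa [mem_sphere_zero_iff_norm.1 hv] using h v

theorem maxStretch_nonneg (A : E n →L[ℝ] E n) : 0 ≤ maxStretch A :=
  Real.sSup_nonneg (by rintro _ ⟨v, _, rfl⟩; exact norm_nonneg _)

theorem minStretch_le_maxStretch (hn : 0 < n) (A : E n →L[ℝ] E n) :
    minStretch A ≤ maxStretch A := by
  obtain ⟨v, hv⟩ := sphere_nonempty hn
  have h1 : minStretch A ≤ ‖A v‖ :=
    csInf_le ⟨0, by rintro _ ⟨w, _, rfl⟩; exact norm_nonneg _⟩ ⟨v, hv, rfl⟩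
  refine h1.trans (le_csSup ⟨‖A‖, ?_⟩ ⟨v, hv, rfl⟩)
  rintro _ ⟨w, hw, rfl⟩
  simpa [mem_sphere_zero_iff_norm.1 hw] using A.le_opNorm w

theorem minStretch_pos (hn : 0 < n) {A : E n →L[ℝ] E n} (hA : A.det ≠ 0) : 0 < minStretch A := by
  have h1 : Function.Injective (A : E n →ₗ[ℝ] E n) := by
    have := (LinearMap.isUnit_iff_isUnit_det (A : E n →ₗ[ℝ] E n)).2 (isUnit_iff_ne_zero.2 hA)
    exact ((Module.End.isUnit_iff _).1 this).injective
  obtain ⟨v, hv, hmin⟩ := (isCompact_sphere (0 : E n) 1).exists_isMinOn (sphere_nonempty hn)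
    A.continuous.norm.continuousOn
  have hv0 : A v ≠ 0 := fun h => by
    have : v = 0 := h1 (by simpa using h)
    simp [this] at hv
  refine (norm_pos_iff.2 hv0).trans_le (le_csInf ((sphere_nonempty hn).image _) ?_)
  rintro _ ⟨w, hw, rfl⟩
  exact hmin hw

/-! ### Homeomorphism -/

theorem quasiInversion_ne_zero (hD : IsStrictlyStarlike D) {x : E n} (hx : x ≠ 0) :
    quasiInversion (frontier D) x ≠ 0 :=
  smul_ne_zero (div_ne_zero (pow_ne_zero 2 (radius_pos hD hx).ne')
    (pow_ne_zero 2 (norm_ne_zero_iff.2 hx))) hx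

theorem norm_quasiInversion (x : E n) :
    ‖quasiInversion M x‖ = radius M x ^ 2 / ‖x‖ := by
  rcases eq_or_ne x 0 with rfl | hx
  · simp [quasiInversion]
  · have := norm_ne_zero_iff.2 hx
    rw [quasiInversion, norm_smul, Real.norm_of_nonneg (by positivity)]
    field_simp

/-- Point and image lie on one ray and share the same radius, so the scaling factors cancel. Being
its own inverse, the map needs only continuity to be a homeomorphism. -/
theorem quasiInversion_quasiInversion (hD : IsStrictlyStarlike D) {x : E n} (hx : x ≠ 0) :
    quasiInversion (frontier D) (quasiInversion (frontier D) x) = x := by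
  have hr := radius_pos hD hx
  have hx' := norm_pos_iff.2 hx
  have h1 : radius (frontier D) (quasiInversion (frontier D) x) = radius (frontier D) x :=
    radius_smul (by positivity)
  rw [quasiInversion, h1, norm_quasiInversion, quasiInversion, smul_smul]
  have : radius (frontier D) x ^ 2 / (radius (frontier D) x ^ 2 / ‖x‖) ^ 2 *
      (radius (frontier D) x ^ 2 / ‖x‖ ^ 2) = 1 := by field_simp
  rw [this, one_smul]

theorem continuousOn_quasiInversion (hD : IsStrictlyStarlike D) :
    ContinuousOn (quasiInversion (frontier D)) {0}ᶜ :=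
  (((continuousOn_radius hD).pow 2).div (continuous_norm.pow 2).continuousOn
    fun _ hx => pow_ne_zero 2 (norm_ne_zero_iff.2 hx)).smul continuousOn_id

theorem isHomeoOn_quasiInversion (hD : IsStrictlyStarlike D) :
    IsHomeoOn (quasiInversion (frontier D)) {0}ᶜ {0}ᶜ :=
  ⟨{ toFun := quasiInversion (frontier D)
     invFun := quasiInversion (frontier D)
     source := {0}ᶜ
     target := {0}ᶜ
     map_source' := fun _ hx => quasiInversion_ne_zero hD hx
     map_target' := fun _ hx => quasiInversion_ne_zero hD hx
     left_inv' := fun _ hx => quasiInversion_quasiInversion hD hx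
     right_inv' := fun _ hx => quasiInversion_quasiInversion hD hx
     open_source := isOpen_compl_singleton
     open_target := isOpen_compl_singleton
     continuousOn_toFun := continuousOn_quasiInversion hD
     continuousOn_invFun := continuousOn_quasiInversion hD }, rfl, rfl, fun _ _ => rfl⟩

theorem quasiInversionExt_infty : quasiInversionExt M OnePoint.infty = ((0 : E n) : OnePoint (E n)) :=
  rfl

theorem quasiInversionExt_zero : quasiInversionExt M ((0 : E n) : OnePoint (E n)) =
    OnePoint.infty := by
  simp [quasiInversionExt]

theorem quasiInversionExt_coe {x : E n} (hx : x ≠ 0) :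
    quasiInversionExt M (x : OnePoint (E n)) = (quasiInversion M x : OnePoint (E n)) := by
  simp [quasiInversionExt, hx]

theorem involutive_quasiInversionExt (hD : IsStrictlyStarlike D) :
    Function.Involutive (quasiInversionExt (frontier D)) := by
  intro p
  induction p using OnePoint.rec with
  | infty => rw [quasiInversionExt_infty, quasiInversionExt_zero]
  | coe x =>
    rcases eq_or_ne x 0 with rfl | hx
    · rw [quasiInversionExt_zero, quasiInversionExt_infty]
    · rw [quasiInversionExt_coe hx, quasiInversionExt_coe (quasiInversion_ne_zero hD hx),
        quasiInversion_quasiInversion hD hx]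

/-- Since `‖f x‖ = ρ² / ‖x‖` with `ρ` between two positive constants, `f` tends to `0` at `∞` and to
`∞` at `0`. -/
theorem continuous_quasiInversionExt (hD : IsStrictlyStarlike D) :
    Continuous (quasiInversionExt (frontier D)) := by
  rw [continuous_iff_continuousAt]
  intro p
  induction p using OnePoint.rec with
  | infty =>
    obtain ⟨R, hR0, hR⟩ := exists_radius_le hD
    rw [OnePoint.continuousAt_infty', quasiInversionExt_infty, Filter.coclosedCompact_eq_cocompact]
    have h0 : ∀ᶠ x : E n in cocompact (E n), x ≠ 0 :=
      isCompact_singleton.compl_mem_cocompact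
    have h1 : Tendsto (quasiInversion (frontier D)) (cocompact (E n)) (𝓝 0) := by
      refine squeeze_zero_norm' (a := fun x => R ^ 2 / ‖x‖) ?_
        (tendsto_const_nhds.div_atTop tendsto_norm_cocompact_atTop)
      filter_upwards [h0] with x hx
      rw [norm_quasiInversion]
      have := hR x hx
      have := radius_pos hD hx
      gcongr
    refine ((OnePoint.continuous_coe.tendsto _).comp h1).congr' ?_
    filter_upwards [h0] with x hx
    exact (quasiInversionExt_coe hx).symm
  | coe x =>
    rw [OnePoint.continuousAt_coe]
    rcases eq_or_ne x 0 with rfl | hx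
    · obtain ⟨R, hR0, hR⟩ := exists_le_radius hD
      rw [continuousAt_iff_punctured_nhds, Function.comp_apply, quasiInversionExt_zero]
      have h1 : Tendsto (quasiInversion (frontier D)) (𝓝[≠] 0) (cocompact (E n)) := by
        rw [← Metric.cobounded_eq_cocompact, ← tendsto_norm_atTop_iff_cobounded]
        have h2 : Tendsto (fun x : E n => R ^ 2 * ‖x‖⁻¹) (𝓝[≠] 0) atTop :=
          (tendsto_inv_nhdsGT_zero.comp tendsto_norm_nhdsNE_zero).const_mul_atTop (by positivity)
        refine tendsto_atTop_mono' _ ?_ h2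
        filter_upwards [self_mem_nhdsWithin] with x hx
        rw [norm_quasiInversion, div_eq_mul_inv]
        have := hR x hx
        gcongr
      rw [← Filter.coclosedCompact_eq_cocompact] at h1
      refine (OnePoint.tendsto_coe_infty.comp h1).congr' ?_
      filter_upwards [self_mem_nhdsWithin] with x hx
      exact (quasiInversionExt_coe hx).symm
    · have h1 := (continuousOn_quasiInversion hD).continuousAt (isOpen_compl_singleton.mem_nhds hx)
      refine (OnePoint.continuous_coe.continuousAt.comp h1).congr ?_
      filter_upwards [isOpen_ne.mem_nhds hx] with y hy
      exact (quasiInversionExt_coe hy).symm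

theorem isHomeomorph_quasiInversionExt (hD : IsStrictlyStarlike D) :
    IsHomeomorph (quasiInversionExt (frontier D)) :=
  Homeomorph.isHomeomorph
    { toEquiv := (involutive_quasiInversionExt hD).toPerm
      continuous_toFun := continuous_quasiInversionExt hD
      continuous_invFun := continuous_quasiInversionExt hD }

/-! ### Absolute continuity on lines -/

/-- The map is a `C¹` function of the pair `(ρ(x), x)`, which is locally Lipschitz in `x`. -/
theorem locallyLipschitzOn_quasiInversion (hD : IsStrictlyStarlike D) {α : ℝ}
    (hα : TangentCondition D α) : LocallyLipschitzOn {0}ᶜ (quasiInversion (frontier D)) := by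
  intro x hx
  obtain ⟨K, s, hs, hK⟩ := locallyLipschitzOn_radius hD hα hx
  have hΦ : ContDiffAt ℝ 1 (fun p : ℝ × E n => (p.1 ^ 2 / ‖p.2‖ ^ 2) • p.2)
      (radius (frontier D) x, x) :=
    ((contDiffAt_fst.pow 2).div (contDiffAt_snd.norm_sq ℝ)
      (pow_ne_zero 2 (norm_ne_zero_iff.2 hx))).smul contDiffAt_snd
  obtain ⟨C, t, ht, hC⟩ := hΦ.exists_lipschitzOnWith
  have hg : LipschitzOnWith (max K 1) (fun y => (radius (frontier D) y, y)) s :=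
    hK.prodMk LipschitzWith.id.lipschitzOnWith
  have hgc : ContinuousWithinAt (fun y => (radius (frontier D) y, y)) {0}ᶜ x :=
    (continuousOn_radius hD x hx).prodMk continuousWithinAt_id
  refine ⟨C * max K 1, s ∩ (fun y => (radius (frontier D) y, y)) ⁻¹' t,
    inter_mem hs (hgc ht), ?_⟩
  have h := hC.comp (hg.mono (inter_subset_left (t := (fun y => (radius (frontier D) y, y)) ⁻¹' t)))
    fun y hy => hy.2
  rw [lipschitzOnWith_iff_dist_le_mul] at h ⊢
  exact h

theorem lipschitzWith_linePoint (k : Fin n) (y : {i : Fin n // i ≠ k} → ℝ) :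
    LipschitzWith 1 (linePoint k y) := by
  refine LipschitzWith.of_dist_le_mul fun s t => ?_
  have h : linePoint k y s - linePoint k y t = EuclideanSpace.single k (s - t) := by
    ext i
    by_cases hi : i = k <;> simp [linePoint, hi]
  rw [dist_eq_norm, h, PiLp.norm_single, Real.dist_eq, NNReal.coe_one, one_mul,
    Real.norm_eq_abs]

/-- A locally Lipschitz map is Lipschitz on each compact segment, so every segment qualifies, not
just almost every one. -/
theorem isACL_of_locallyLipschitzOn {f : E n → E n} {U : Set (E n)}
    (hf : LocallyLipschitzOn U f) : IsACL f U := by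
  refine ⟨hf.continuousOn, fun a b hab hU k => Eventually.of_forall fun y hy => ?_⟩
  have hsub : linePoint k y '' Icc (a k) (b k) ⊆ U := by
    rintro _ ⟨t, ht, rfl⟩
    refine hU fun i => ?_
    by_cases hi : i = k
    · subst hi
      simpa [linePoint] using ht
    · simpa [linePoint, hi] using hy ⟨i, hi⟩
  obtain ⟨K, hK⟩ := (hf.mono hsub).exists_lipschitzOnWith_of_compact
    (isCompact_Icc.image (lipschitzWith_linePoint k y).continuous)
  refine LipschitzOnWith.absolutelyContinuousOnInterval (K := K * 1) ?_
  rw [uIcc_of_le (hab k).le]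
  exact hK.comp (lipschitzWith_linePoint k y).lipschitzOnWith (mapsTo_image _ _)

/-! ### Quasiconformality -/

theorem ae_hasFDerivAt_quasiInversion (hD : IsStrictlyStarlike D) {α : ℝ}
    (hα : TangentCondition D α) :
    ∀ᵐ x ∂(volume.restrict ({0}ᶜ : Set (E n))), x ≠ 0 ∧
      DifferentiableAt ℝ (radius (frontier D)) x ∧
      HasFDerivAt (quasiInversion (frontier D)) ((radius (frontier D) x ^ 2 / ‖x‖ ^ 2) •
      (ContinuousLinearMap.id ℝ (E n) +
        (quasiInversionFunctional (frontier D) x).smulRight x)) x := by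
  filter_upwards [ae_differentiableAt_radius hD hα,
    ae_restrict_mem isOpen_compl_singleton.measurableSet] with x hd hx
  exact ⟨hx, hd, hasFDerivAt_quasiInversion hx (radius_pos hD hx).ne' hd⟩

/-- With `c = ρ² / ‖x‖²`, each stretching departs from `c` by at most the factor `cot (α/2)`; their
quotient produces the square in `K`. -/
theorem ae_stretch_quasiInversion (hn : 0 < n) (hD : IsStrictlyStarlike D) {α : ℝ}
    (hα : TangentCondition D α) :
    ∀ᵐ x ∂(volume.restrict ({0}ᶜ : Set (E n))), ∃ c : ℝ, 0 < c ∧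
      (fderiv ℝ (quasiInversion (frontier D)) x).det = -c ^ n ∧
      maxStretch (fderiv ℝ (quasiInversion (frontier D)) x) ≤ c * Real.cot (α / 2) ∧
      c / Real.cot (α / 2) ≤ minStretch (fderiv ℝ (quasiInversion (frontier D)) x) := by
  filter_upwards [ae_hasFDerivAt_quasiInversion hD hα] with x hx
  obtain ⟨hx0, hd, hf⟩ := hx
  have hr := radius_pos hD hx0
  have hx' := norm_pos_iff.2 hx0
  have hσ : 0 < Real.cot (α / 2) := one_pos.trans_le (one_le_cot_half hα.1 hα.2.1)
  rw [hf.fderiv]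
  have hc : 0 < radius (frontier D) x ^ 2 / ‖x‖ ^ 2 := by positivity
  refine ⟨radius (frontier D) x ^ 2 / ‖x‖ ^ 2, hc, det_quasiInversionFunctional hx0 hd _,
    maxStretch_le (by positivity) fun v => ?_, le_minStretch hn fun v => ?_⟩
  · have := (norm_shear_bounds hD hα hx0 hd v).1
    simp only [smul_apply, add_apply, ContinuousLinearMap.id_apply,
      ContinuousLinearMap.smulRight_apply, norm_smul, Real.norm_of_nonneg hc.le]
    rw [mul_assoc]
    gcongr
  · have := (norm_shear_bounds hD hα hx0 hd v).2
    simp only [smul_apply, add_apply, ContinuousLinearMap.id_apply,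
      ContinuousLinearMap.smulRight_apply, norm_smul, Real.norm_of_nonneg hc.le]
    rw [div_mul_eq_mul_div, div_le_iff₀ hσ, mul_assoc, mul_comm _ (Real.cot (α / 2))]
    gcongr

theorem isQuasiconformal_quasiInversion (hn : 0 < n) (hD : IsStrictlyStarlike D) {α : ℝ}
    (hα : TangentCondition D α) :
    IsQuasiconformal (quasiInversion (frontier D)) {0}ᶜ {0}ᶜ where
  homeo := isHomeoOn_quasiInversion hD
  acl := isACL_of_locallyLipschitzOn (locallyLipschitzOn_quasiInversion hD hα)
  ae_differentiable :=
    (ae_hasFDerivAt_quasiInversion hD hα).mono fun _ hx => hx.2.2.differentiableAt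
  bounded_dilatation := by
    have hσ := one_le_cot_half hα.1 hα.2.1
    have hσ0 : 0 < Real.cot (α / 2) := one_pos.trans_le hσ
    refine ⟨Real.cot (α / 2) ^ n, one_le_pow₀ hσ, ?_⟩
    filter_upwards [ae_stretch_quasiInversion hn hD hα] with x hx
    obtain ⟨c, hc, hdet, hmax, hmin⟩ := hx
    rw [hdet, abs_neg, abs_of_pos (by positivity)]
    constructor
    · rw [div_le_iff₀ (by positivity), ← mul_pow]
      exact pow_le_pow_left₀ (maxStretch_nonneg _) hmax n
    · rw [← mul_pow]
      refine pow_le_pow_left₀ hc.le ?_ n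
      rwa [div_le_iff₀ hσ0, mul_comm] at hmin

theorem isKQuasiconformal_quasiInversion (hn : 0 < n) (hD : IsStrictlyStarlike D) {α : ℝ}
    (hα : TangentCondition D α) :
    IsKQuasiconformal (Real.cot (α / 2) ^ 2) (quasiInversion (frontier D)) {0}ᶜ {0}ᶜ := by
  refine ⟨isQuasiconformal_quasiInversion hn hD hα, ?_⟩
  have hσ0 : 0 < Real.cot (α / 2) := one_pos.trans_le (one_le_cot_half hα.1 hα.2.1)
  filter_upwards [ae_stretch_quasiInversion hn hD hα] with x hx
  obtain ⟨c, hc, hdet, hmax, hmin⟩ := hx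
  refine ⟨by rw [hdet]; exact neg_ne_zero.2 (by positivity), ?_⟩
  calc _ ≤ c * Real.cot (α / 2) / (c / Real.cot (α / 2)) := by gcongr
    _ = _ := by field_simp

/-- The punctured space has positive measure, so some point satisfies the a.e. conditions; there `λ
> 0` and `λ ≤ Λ`. -/
theorem one_le_of_isKQuasiconformal (hn : 0 < n) {f : E n → E n} {K : ℝ}
    (hf : IsKQuasiconformal K f {0}ᶜ {0}ᶜ) : 1 ≤ K := by
  have : Nonempty (Fin n) := ⟨⟨0, hn⟩⟩
  have hne : (volume.restrict ({0}ᶜ : Set (E n))) ≠ 0 := by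
    rw [Ne, Measure.restrict_eq_zero]
    exact (isOpen_compl_singleton.measure_pos volume (exists_ne 0)).ne'
  have := ae_neBot.2 hne
  obtain ⟨x, hdet, hK⟩ := hf.2.exists
  refine le_trans ?_ hK
  rw [one_le_div (minStretch_pos hn hdet)]
  exact minStretch_le_maxStretch hn _

/-! ### The planar case -/

/-- If `F h = c (h + ℓ(h) z)` with `ℓ(z) = -2`, then the complex dilatation of `conj F` is
controlled by `ℓ(iz)`. -/
theorem norm_dilatation_le {z : ℂ} {p q c k : ℝ} (hc : 0 < c) (hk : 0 ≤ k)
    (h1 : p * z.re + q * z.im = -2)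
    (h2 : (q * z.re - p * z.im) ^ 2 ≤ k ^ 2 * (4 + (q * z.re - p * z.im) ^ 2)) :
    ‖((star ((c : ℂ) * (1 + p * z)) + Complex.I * star ((c : ℂ) * (Complex.I + q * z))) / 2) /
      ((star ((c : ℂ) * (1 + p * z)) - Complex.I * star ((c : ℂ) * (Complex.I + q * z))) / 2)‖
      ≤ k := by
  set τ := q * z.re - p * z.im with hτ
  -- With `p = ℓ(1)` and `q = ℓ(i)`, `τ` is `ℓ(iz)`. Here and in `e2` the relation `ℓ(z) = -2`
  -- reduces the quotient to `|μ|² = τ² / (4 + τ²)`.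
  have e1 : star ((c : ℂ) * (1 + p * z)) + Complex.I * star ((c : ℂ) * (Complex.I + q * z)) =
      c * (τ * Complex.I) := by
    apply Complex.ext
    · simp
      linear_combination c * h1
    · simp [hτ]
      ring
  have e2 : ‖star ((c : ℂ) * (1 + p * z)) - Complex.I * star ((c : ℂ) * (Complex.I + q * z))‖ ^ 2 =
      c ^ 2 * (4 + τ ^ 2) := by
    rw [Complex.sq_norm, Complex.normSq_apply]
    simp [hτ]
    linear_combination c ^ 2 * (p * z.re + q * z.im - 2) * h1
  have hpos : 0 < ‖star ((c : ℂ) * (1 + p * z)) -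
      Complex.I * star ((c : ℂ) * (Complex.I + q * z))‖ := by
    rcases (norm_nonneg (star ((c : ℂ) * (1 + p * z)) -
      Complex.I * star ((c : ℂ) * (Complex.I + q * z)))).eq_or_lt with h | h
    · rw [← h] at e2
      have : 0 < c ^ 2 * (4 + τ ^ 2) := by positivity
      linarith
    · exact h
  rw [div_div_div_cancel_right₀ two_ne_zero, norm_div, div_le_iff₀ hpos, e1]
  refine le_of_sq_le_sq ?_ (by positivity)
  rw [mul_pow, e2]
  simp only [norm_mul, Complex.norm_real, Complex.norm_I, mul_one, mul_pow, Real.norm_eq_abs,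
    sq_abs]
  have := mul_le_mul_of_nonneg_left h2 (sq_nonneg c)
  linarith

theorem inner_complexToPlane (z w : ℂ) :
    inner ℝ (complexToPlane z) (complexToPlane w) = z.re * w.re + z.im * w.im := by
  rw [LinearIsometryEquiv.inner_map_map, Complex.inner]
  simp [mul_comm]

theorem isSmallKQuasiconformal_quasiInversion {D : Set (E 2)} (hD : IsStrictlyStarlike D) {α : ℝ}
    (hα : TangentCondition D α) :
    IsSmallKQuasiconformal (Real.cos α) (quasiInversion (frontier D)) {0}ᶜ {0}ᶜ := by
  refine ⟨isQuasiconformal_quasiInversion two_pos hD hα, ?_⟩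
  have hcos : 0 ≤ Real.cos α :=
    Real.cos_nonneg_of_mem_Icc ⟨by linarith [hα.1, Real.pi_pos], hα.2.1⟩
  filter_upwards [ae_hasFDerivAt_quasiInversion hD hα] with x hx
  obtain ⟨hx0, hd, hf⟩ := hx
  have hr := radius_pos hD hx0
  have hx' := norm_pos_iff.2 hx0
  have hdet := det_quasiInversionFunctional hx0 hd (radius (frontier D) x ^ 2 / ‖x‖ ^ 2)
  obtain ⟨c, hc⟩ : ∃ c, c = radius (frontier D) x ^ 2 / ‖x‖ ^ 2 := ⟨_, rfl⟩
  have hc0 : 0 < c := by rw [hc]; positivity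
  rw [← hc] at hdet hf
  rw [hf.fderiv, hdet]
  have hc2 : 0 < c ^ 2 := by positivity
  -- The determinant is `-c²`: the map reverses orientation, so only its conjugate has to be
  -- examined.
  refine ⟨by linarith, fun h => absurd h (by linarith), fun _ => ?_⟩
  obtain ⟨z, rfl⟩ := complexToPlane.surjective x
  rw [complexToPlane.symm_apply_apply]
  set ℓ := quasiInversionFunctional (frontier D) (complexToPlane z) with hℓ
  set L := fderiv ℝ (radius (frontier D)) (complexToPlane z) with hL
  have hz : z ≠ 0 := fun h => hx0 (by simp [h])
  have hlin : ∀ w : ℂ, complexToPlane w =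
      w.re • complexToPlane 1 + w.im • complexToPlane Complex.I := fun w => by
    rw [← map_smul, ← map_smul, ← map_add]
    congr 1
    apply Complex.ext <;> simp
  have hF : HasFDerivAt (fun w => star (complexForm (quasiInversion (frontier D)) w)) _ z :=
    (Complex.conjCLE : ℂ →L[ℝ] ℂ).hasFDerivAt.comp z
      ((complexToPlane.symm.toContinuousLinearEquiv : E 2 →L[ℝ] ℂ).hasFDerivAt.comp z
        (hf.comp z (complexToPlane.toContinuousLinearEquiv : ℂ →L[ℝ] E 2).hasFDerivAt))
  have hval : ∀ w : ℂ, fderiv ℝ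
      (fun w => star (complexForm (quasiInversion (frontier D)) w)) z w =
      star ((c : ℂ) * (w + ℓ (complexToPlane w) * z)) := fun w => by
    rw [hF.fderiv]
    simp [mul_add]
  have hLz : L (complexToPlane z) = 0 := fderiv_radius_self hd
  have hℓv : ∀ w : ℂ, ℓ (complexToPlane w) =
      2 / radius (frontier D) (complexToPlane z) * L (complexToPlane w) -
        2 / ‖z‖ ^ 2 * (z.re * w.re + z.im * w.im) := fun w => by
    simp only [hℓ, quasiInversionFunctional, sub_apply, smul_apply, innerSL_apply_apply,
      inner_complexToPlane, ← hL, smul_eq_mul, LinearIsometryEquiv.norm_map]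
  have hzz : ‖z‖ ^ 2 = z.re * z.re + z.im * z.im := by
    rw [Complex.sq_norm, Complex.normSq_apply]
  have hz2 : ‖z‖ ^ 2 ≠ 0 := pow_ne_zero 2 (norm_ne_zero_iff.2 hz)
  have h1 : ℓ (complexToPlane 1) * z.re + ℓ (complexToPlane Complex.I) * z.im = -2 := by
    have : ℓ (complexToPlane z) = -2 := by
      rw [hℓv, hLz, ← hzz]
      field_simp
      ring
    rw [hlin z, map_add, map_smul, map_smul, smul_eq_mul, smul_eq_mul] at this
    linarith
  have h2 : ℓ (complexToPlane Complex.I) * z.re - ℓ (complexToPlane 1) * z.im =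
      2 / radius (frontier D) (complexToPlane z) * L (complexToPlane (Complex.I * z)) := by
    have : ℓ (complexToPlane (Complex.I * z)) =
      2 / radius (frontier D) (complexToPlane z) * L (complexToPlane (Complex.I * z)) := by
      rw [hℓv]
      simp
      right
      ring
    rw [← this, hlin (Complex.I * z), map_add, map_smul, map_smul]
    simp
    ring
  have horth : inner ℝ (complexToPlane z) (complexToPlane (Complex.I * z)) = 0 := by
    rw [inner_complexToPlane]
    simp
    ring
  have hang := abs_fderiv_radius_le hD hα hx0 hd horth
  rw [LinearIsometryEquiv.norm_map, LinearIsometryEquiv.norm_map, norm_mul, Complex.norm_I,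
    one_mul, ← mul_assoc, ← mul_assoc, mul_le_mul_iff_left₀ (norm_pos_iff.2 hz), ← hL] at hang
  simp only [complexDilatation, dz, dzbar, hval]
  refine norm_dilatation_le hc0 hcos h1 ?_
  rw [h2]
  set T := L (complexToPlane (Complex.I * z))
  have hsin : 0 ≤ Real.sin α :=
    Real.sin_nonneg_of_nonneg_of_le_pi hα.1.le (by linarith [Real.pi_pos, hα.2.1])
  have h3 := pow_le_pow_left₀ (by positivity) hang 2
  rw [mul_pow, sq_abs, Real.sin_sq] at h3
  set ρ := radius (frontier D) (complexToPlane z)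
  -- The tangential bound `sin α |T| ≤ cos α ρ`, squared, in the form required by
  -- `norm_dilatation_le`.
  have h4 : (2 / ρ * T) ^ 2 * (1 - Real.cos α ^ 2) ≤ 4 * Real.cos α ^ 2 := by
    have : (2 / ρ * T) ^ 2 * (1 - Real.cos α ^ 2) =
        4 / ρ ^ 2 * ((1 - Real.cos α ^ 2) * T ^ 2) := by ring
    rw [this]
    calc _ ≤ 4 / ρ ^ 2 * (Real.cos α * ρ) ^ 2 := by gcongr
      _ = _ := by field_simp
  linarith

/-! ### Lipschitz estimates from almost everywhere bounds of the derivative -/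

theorem frequently_nhds_of_ae {F : Type*} [TopologicalSpace F] [MeasurableSpace F]
    {μ : Measure F} [μ.IsOpenPosMeasure] {p : F → Prop} (h : ∀ᵐ v ∂μ, p v) (x : F) :
    ∃ᶠ v in 𝓝 x, p v :=
  mem_closure_iff_frequently.1 (Measure.dense_of_ae h x)

/-- For fixed `s` the exceptional `v` form a translate of a null set; Fubini exchanges the two
quantifiers. -/
theorem ae_ae_add_smul {F : Type*} [NormedAddCommGroup F] [NormedSpace ℝ F]
    [FiniteDimensional ℝ F] [MeasurableSpace F] [BorelSpace F] {μ : Measure F}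
    [μ.IsAddHaarMeasure] {p : F → Prop} (h : ∀ᵐ x ∂μ, p x) (x w : F) :
    ∀ᵐ v ∂μ, ∀ᵐ s : ℝ, p (x + v + s • w) := by
  -- The exceptional set need not be measurable, so Fubini is applied to a measurable null set
  -- containing it.
  have hN := measurableSet_toMeasurable μ {x | ¬ p x}
  have hN0 : μ (toMeasurable μ {x | ¬ p x}) = 0 := by
    rw [measure_toMeasurable]; exact ae_iff.1 h
  have hN' : ∀ᵐ y ∂μ, y ∉ toMeasurable μ {x | ¬ p x} := measure_eq_zero_iff_ae_notMem.1 hN0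
  have hcont : Continuous fun q : F × ℝ => x + q.1 + q.2 • w := by fun_prop
  have key : ∀ᵐ v ∂μ, ∀ᵐ s : ℝ, x + v + s • w ∉ toMeasurable μ {x | ¬ p x} := by
    have hS : MeasurableSet
        {q : F × ℝ | x + q.1 + q.2 • w ∉ toMeasurable μ {x | ¬ p x}} :=
      hcont.measurable hN.compl
    rw [Measure.ae_ae_comm hS]
    refine Eventually.of_forall fun s => ?_
    have := (measurePreserving_add_left μ (x + s • w)).quasiMeasurePreserving.ae hN'
    filter_upwards [this] with v hv
    rwa [add_right_comm]
  filter_upwards [key] with v hv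
  filter_upwards [hv] with s hs
  by_contra hp
  exact hs (subset_toMeasurable _ _ hp)

/-- An a.e. bound may fail all along the segment from `x` to `y`. On almost every translate by `v`
it holds at almost every point, and integrating the derivative there gives the estimate; then `v →
0` through good values. -/
theorem abs_sub_le_of_ae_norm_fderiv_le {F : Type*} [NormedAddCommGroup F] [NormedSpace ℝ F]
    [FiniteDimensional ℝ F] [MeasurableSpace F] [BorelSpace F] {μ : Measure F}
    [μ.IsAddHaarMeasure] {U : Set F} (hU : IsOpen U) (hUc : Convex ℝ U) {f : F → ℝ}
    (hf : LocallyLipschitzOn U f) {C : ℝ}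
    (hC : ∀ᵐ x ∂(μ.restrict U), DifferentiableAt ℝ f x ∧ ‖fderiv ℝ f x‖ ≤ C) {x y : F}
    (hx : x ∈ U) (hy : y ∈ U) : |f y - f x| ≤ C * ‖y - x‖ := by
  rw [ae_restrict_iff' hU.measurableSet] at hC
  have htx : Tendsto (fun v => x + v) (𝓝 0) (𝓝 x) := by
    simpa using (continuous_const.add continuous_id).tendsto (0 : F) (f := fun v => x + v)
  have hty : Tendsto (fun v => y + v) (𝓝 0) (𝓝 y) := by
    simpa using (continuous_const.add continuous_id).tendsto (0 : F) (f := fun v => y + v)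
  have key : ∀ᵐ v ∂μ, x + v ∈ U → y + v ∈ U → |f (y + v) - f (x + v)| ≤ C * ‖y - x‖ := by
    filter_upwards [ae_ae_add_smul hC x (y - x)] with v hv hxv hyv
    have hseg : ∀ s ∈ Icc (0 : ℝ) 1, x + v + s • (y - x) ∈ U := fun s hs => by
      have := hUc.add_smul_sub_mem hxv hyv hs
      rwa [add_sub_add_right_eq_sub] at this
    have hcurve : ∀ s : ℝ, HasDerivAt (fun s : ℝ => x + v + s • (y - x)) (y - x) s := fun s => by
      simpa using ((hasDerivAt_id s).smul_const (y - x)).const_add (x + v)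
    have hlip : LipschitzWith ‖y - x‖₊ (fun s : ℝ => x + v + s • (y - x)) := by
      refine LipschitzWith.of_dist_le_mul fun s t => ?_
      rw [dist_add_left, dist_eq_norm, ← sub_smul, norm_smul, ← dist_eq_norm, mul_comm,
        coe_nnnorm]
    obtain ⟨K, hK⟩ := (hf.mono (image_subset_iff.2 hseg)).exists_lipschitzOnWith_of_compact
      (isCompact_Icc.image hlip.continuous)
    have hac : AbsolutelyContinuousOnInterval (fun s : ℝ => f (x + v + s • (y - x))) 0 1 := by
      refine LipschitzOnWith.absolutelyContinuousOnInterval (K := K * ‖y - x‖₊) ?_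
      rw [uIcc_of_le zero_le_one]
      exact hK.comp hlip.lipschitzOnWith (mapsTo_image _ _)
    have hint := hac.integral_deriv_eq_sub
    have hbound : ∀ᵐ s : ℝ, s ∈ uIoc (0 : ℝ) 1 →
        ‖deriv (fun s : ℝ => f (x + v + s • (y - x))) s‖ ≤ C * ‖y - x‖ := by
      filter_upwards [hv] with s hs hs01
      rw [uIoc_of_le zero_le_one] at hs01
      obtain ⟨hd, hle⟩ := hs (hseg s ⟨hs01.1.le, hs01.2⟩)
      have := hd.hasFDerivAt.comp_hasDerivAt s (hcurve s)
      rw [show (fun s : ℝ => f (x + v + s • (y - x))) = f ∘ fun s : ℝ => x + v + s • (y - x) from rfl,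
        this.deriv]
      exact (fderiv ℝ f _).le_of_opNorm_le hle _
    have := intervalIntegral.norm_integral_le_of_norm_le_const_ae hbound
    rw [hint] at this
    have e : x + v + (y - x) = y + v := by abel
    simpa [e] using this
  have hfc : ∀ z ∈ U, ContinuousAt f z := fun z hz =>
    hf.continuousOn.continuousAt (hU.mem_nhds hz)
  have hlim : Tendsto (fun v => |f (y + v) - f (x + v)|) (𝓝 0) (𝓝 |f y - f x|) :=
    (((hfc y hy).tendsto.comp hty).sub ((hfc x hx).tendsto.comp htx)).abs
  refine le_of_tendsto_of_frequently hlim ?_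
  refine ((frequently_nhds_of_ae key 0).and_eventually
    ((htx.eventually (hU.mem_nhds hx)).and (hty.eventually (hU.mem_nhds hy)))).mono ?_
  exact fun v hv => hv.1 hv.2.1 hv.2.2

/-- A property of almost all points of the unit sphere holds along almost all rays. -/
theorem ae_of_ae_toSphere {p : E n → Prop}
    (h : ∀ᵐ ω : Metric.sphere (0 : E n) 1 ∂(volume : Measure (E n)).toSphere, p (ω : E n)) :
    ∀ᵐ x ∂(volume.restrict ({0}ᶜ : Set (E n))), p (‖x‖⁻¹ • x) := by
  rw [ae_restrict_iff_subtype isOpen_compl_singleton.measurableSet]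
  have h1 := (Measure.measurePreserving_homeomorphUnitSphereProd
    (volume : Measure (E n))).quasiMeasurePreserving.ae
    (Measure.quasiMeasurePreserving_fst.ae h)
  filter_upwards [h1] with x hx
  simpa using hx

/-! ### From smooth convergence to the tangent angle -/

theorem radialExtension_eq {x : E n} (hx : x ≠ 0) : radialExtension M x = radius M x • x := by
  have hx' := norm_pos_iff.2 hx
  rw [radialExtension, polarMap, radius_smul (inv_pos.2 hx'), smul_comm, smul_smul ‖x‖,
    mul_inv_cancel₀ hx'.ne', one_smul]

/-- At the unit vector `ω = x/‖x‖` the radial extension has derivative `v ↦ ρ v + ‖x‖ L(v) ω`. Since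
`L ω = 0`, testing on `ω` isolates `ρ - r`; subtracting that part costs a second `ε` in the bound
for `L`. -/
theorem radius_bounds_of_norm_fderiv_radialExtension_le {x : E n} (hx : x ≠ 0) {r ε : ℝ}
    (hd : DifferentiableAt ℝ (radius M) x)
    (h : ‖fderiv ℝ (radialExtension M) (‖x‖⁻¹ • x) - r • ContinuousLinearMap.id ℝ (E n)‖ ≤ ε) :
    |radius M x - r| ≤ ε ∧ ‖fderiv ℝ (radius M) x‖ ≤ 2 * ε / ‖x‖ := by
  have hx' := norm_pos_iff.2 hx
  obtain ⟨ω, hω⟩ : ∃ ω, ω = ‖x‖⁻¹ • x := ⟨_, rfl⟩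
  have hω1 : ‖ω‖ = 1 := by rw [hω, norm_smul, norm_inv, norm_norm, inv_mul_cancel₀ hx'.ne']
  have hω0 : ω ≠ 0 := norm_ne_zero_iff.1 (by rw [hω1]; exact one_ne_zero)
  have hxω : ‖x‖ • ω = x := by rw [hω, smul_smul, mul_inv_cancel₀ hx'.ne', one_smul]
  set L := fderiv ℝ (radius M) x with hL
  have h1 : HasFDerivAt (radius M) (‖x‖ • L) ω := by
    have h2 : HasFDerivAt (radius M) L (‖x‖ • ω) := by rw [hxω]; exact hd.hasFDerivAt
    have h3 : HasFDerivAt (fun y : E n => ‖x‖ • y) (‖x‖ • ContinuousLinearMap.id ℝ (E n)) ω :=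
      (hasFDerivAt_id ω).const_smul ‖x‖
    have h4 := h2.comp ω h3
    rw [show (radius M ∘ fun y : E n => ‖x‖ • y) = radius M from
      funext fun y => radius_smul hx'] at h4
    refine h4.congr_fderiv ?_
    ext v
    simp
  have hρ : radius M ω = radius M x := by rw [hω, radius_smul (inv_pos.2 hx')]
  have h5 : HasFDerivAt (radialExtension M)
      (radius M ω • ContinuousLinearMap.id ℝ (E n) + (‖x‖ • L).smulRight ω) ω := by
    refine (h1.smul (hasFDerivAt_id ω)).congr_of_eventuallyEq ?_
    filter_upwards [isOpen_ne.mem_nhds hω0] with y hy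
    exact radialExtension_eq hy
  rw [← hω, h5.fderiv, hρ] at h
  have hv : ∀ v, ‖(radius M x - r) • v + (‖x‖ * L v) • ω‖ ≤ ε * ‖v‖ := fun v => by
    refine le_trans (le_of_eq ?_) (ContinuousLinearMap.le_of_opNorm_le _ h v)
    congr 1
    simp [sub_smul]
    abel
  have hLω : L ω = 0 := by
    rw [hω, map_smul, fderiv_radius_self hd, smul_zero]
  have hr : |radius M x - r| ≤ ε := by
    have := hv ω
    rwa [hLω, mul_zero, zero_smul, add_zero, norm_smul, hω1, mul_one, mul_one,
      Real.norm_eq_abs] at this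
  have hε : 0 ≤ ε := (abs_nonneg _).trans hr
  refine ⟨hr, ContinuousLinearMap.opNorm_le_bound _ (by positivity) fun v => ?_⟩
  have h6 : ‖(‖x‖ * L v) • ω‖ ≤ ε * ‖v‖ + ε * ‖v‖ := by
    have : (‖x‖ * L v) • ω = ((radius M x - r) • v + (‖x‖ * L v) • ω) - (radius M x - r) • v := by
      abel
    rw [this]
    refine (norm_sub_le _ _).trans (add_le_add (hv v) ?_)
    rw [norm_smul, Real.norm_eq_abs]
    gcongr
  rw [norm_smul, hω1, mul_one, norm_mul, norm_norm] at h6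
  rw [div_mul_eq_mul_div, le_div_iff₀ hx']
  linarith

theorem ae_radius_bounds (hD : IsStrictlyStarlike D) {α r ε : ℝ}
    (hα : TangentCondition D α) (hε : 0 ≤ ε)
    (h : essSup (fun x : Metric.sphere (0 : E n) 1 =>
        ‖fderiv ℝ (radialExtension (frontier D)) (x : E n)
          - r • ContinuousLinearMap.id ℝ (E n)‖ₑ) (volume : Measure (E n)).toSphere
      ≤ ENNReal.ofReal ε) :
    ∀ᵐ x ∂(volume.restrict ({0}ᶜ : Set (E n))), x ≠ 0 ∧
      DifferentiableAt ℝ (radius (frontier D)) x ∧ |radius (frontier D) x - r| ≤ ε ∧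
      ‖fderiv ℝ (radius (frontier D)) x‖ ≤ 2 * ε / ‖x‖ := by
  have h1 : ∀ᵐ ω : Metric.sphere (0 : E n) 1 ∂(volume : Measure (E n)).toSphere,
      ‖fderiv ℝ (radialExtension (frontier D)) (ω : E n) -
        r • ContinuousLinearMap.id ℝ (E n)‖ ≤ ε := by
    filter_upwards [ENNReal.ae_le_essSup (μ := (volume : Measure (E n)).toSphere)
      (fun x : Metric.sphere (0 : E n) 1 =>
        ‖fderiv ℝ (radialExtension (frontier D)) (x : E n)
          - r • ContinuousLinearMap.id ℝ (E n)‖ₑ)] with ω hω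
    have := hω.trans h
    rwa [← ofReal_norm, ENNReal.ofReal_le_ofReal_iff hε] at this
  filter_upwards [ae_of_ae_toSphere (p := fun ω => ‖fderiv ℝ (radialExtension (frontier D)) ω -
      r • ContinuousLinearMap.id ℝ (E n)‖ ≤ ε) h1, ae_differentiableAt_radius hD hα,
    ae_restrict_mem isOpen_compl_singleton.measurableSet] with x hx hd hx0
  exact ⟨hx0, hd, radius_bounds_of_norm_fderiv_radialExtension_le hx0 hd hx⟩

/-- On the surface `ρ` equals the norm, so a small Lipschitz constant makes `‖z‖ - ‖x‖` small
against `‖z - x‖`. The identity `2⟨z - x, x⟩ = ‖z‖² - ‖x‖² - ‖z - x‖²` then forces the segment to be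
nearly orthogonal to `x`. -/
theorem le_angleAt_of_ae_radius_bounds (hD : IsStrictlyStarlike D) {α r ε β : ℝ}
    (hα : TangentCondition D α) (hr : 0 < r) (hε : 0 < ε) (hεr : ε ≤ r / 2)
    (hβ' : β ≤ Real.pi) (hβε : 14 * ε / r ≤ Real.cos β)
    (h : ∀ᵐ x ∂(volume.restrict ({0}ᶜ : Set (E n))), x ≠ 0 ∧
      DifferentiableAt ℝ (radius (frontier D)) x ∧ |radius (frontier D) x - r| ≤ ε ∧
      ‖fderiv ℝ (radius (frontier D)) x‖ ≤ 2 * ε / ‖x‖) {x : E n} (hx : x ∈ frontier D) :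
    β ≤ angleAt (frontier D) x := by
  have := neBot_of_angleAt_pos (hα.1.trans_le (hα.2.2 x hx))
  have hx0 : x ≠ 0 := fun h => hD.zero_notMem_frontier (h ▸ hx)
  have hx' := norm_pos_iff.2 hx0
  have hxr : r / 2 ≤ ‖x‖ := by
    rw [← radius_of_mem_frontier hD hx]
    have hc : ContinuousAt (fun y => |radius (frontier D) y - r|) x :=
      (((continuousOn_radius hD).continuousAt (isOpen_compl_singleton.mem_nhds hx0)).sub
        continuousAt_const).abs
    -- The a.e. bound holds on a dense set, and continuity carries it to the given point.
    have h1 : |radius (frontier D) x - r| ≤ ε := by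
      refine le_of_tendsto_of_frequently hc.tendsto ?_
      rw [ae_restrict_iff' isOpen_compl_singleton.measurableSet] at h
      exact ((frequently_nhds_of_ae h x).and_eventually
        (isOpen_compl_singleton.mem_nhds hx0)).mono fun y hy => (hy.1 hy.2).2.2.1
    linarith [(abs_le.1 h1).1]
  have hsub : Metric.ball x (‖x‖ / 2) ⊆ {0}ᶜ := fun y hy =>
    norm_pos_iff.1 (lt_trans (by positivity) (half_norm_lt_of_mem_ball hy))
  have hlip : ∀ z ∈ Metric.ball x (‖x‖ / 2),
      |radius (frontier D) z - radius (frontier D) x| ≤ 4 * ε / ‖x‖ * ‖z - x‖ := fun z hz => by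
    refine abs_sub_le_of_ae_norm_fderiv_le (μ := volume) Metric.isOpen_ball (convex_ball _ _)
      ((locallyLipschitzOn_radius hD hα).mono hsub) ?_ (Metric.mem_ball_self (by positivity)) hz
    filter_upwards [ae_restrict_of_ae_restrict_of_subset hsub h,
      ae_restrict_mem Metric.isOpen_ball.measurableSet] with w hw hwb
    refine ⟨hw.2.1, hw.2.2.2.trans ?_⟩
    have := half_norm_lt_of_mem_ball hwb
    calc 2 * ε / ‖w‖ ≤ 2 * ε / (‖x‖ / 2) := by gcongr
      _ = _ := by field_simp; ring
  refine le_angleAt ?_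
  filter_upwards [self_mem_nhdsWithin,
    nhdsWithin_le_nhds (Metric.ball_mem_nhds x (show 0 < ‖x‖ / 2 by positivity)),
    nhdsWithin_le_nhds (Metric.ball_mem_nhds x hε)] with z hz hz1 hz2
  refine le_acuteAngle_of_abs_inner_le hβ' hz.2 hx0 ?_
  have h1 := hlip z hz1
  rw [radius_of_mem_frontier hD hx, radius_of_mem_frontier hD hz.1] at h1
  rw [mem_ball_iff_norm] at hz1 hz2
  have hz3 : ‖z‖ ≤ 2 * ‖x‖ := by linarith [norm_sub_norm_le z x]
  have h2 : ‖z‖ ^ 2 = ‖z - x‖ ^ 2 + 2 * inner ℝ (z - x) x + ‖x‖ ^ 2 := by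
    rw [← norm_add_sq_real, sub_add_cancel]
  have h3 : 2 * inner ℝ (z - x) x = (‖z‖ - ‖x‖) * (‖z‖ + ‖x‖) - ‖z - x‖ ^ 2 := by
    linarith
  -- The terms add up to `13 ε ‖z - x‖`, rounded up to `14`: `12` is the Lipschitz factor `4` times
  -- `‖z‖ + ‖x‖ ≤ 3 ‖x‖`, and `1` comes from `‖z - x‖ < ε`. Halving and using `‖x‖ ≥ r / 2` leads to
  -- `14 ε / r`.
  have h4 : |2 * inner ℝ (z - x) x| ≤ 4 * ε / ‖x‖ * ‖z - x‖ * (3 * ‖x‖) + ε * ‖z - x‖ := by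
    rw [h3]
    refine (abs_sub _ _).trans (add_le_add ?_ ?_)
    · rw [abs_mul, abs_of_nonneg (a := ‖z‖ + ‖x‖) (by positivity)]
      gcongr
      linarith
    · rw [abs_of_nonneg (by positivity), pow_two]
      gcongr
  have h5 : 4 * ε / ‖x‖ * ‖z - x‖ * (3 * ‖x‖) = 12 * ε * ‖z - x‖ := by field_simp; ring
  rw [h5, abs_mul, abs_two] at h4
  have h6 : 7 * ε ≤ Real.cos β * ‖x‖ := by
    have hc : 0 ≤ Real.cos β := le_trans (by positivity) hβε
    calc 7 * ε = 14 * ε / r * (r / 2) := by field_simp; ring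
      _ ≤ _ := by gcongr
  have h7 := mul_le_mul_of_nonneg_right h6 (norm_nonneg (z - x))
  have h8 : 0 ≤ ε * ‖z - x‖ := by positivity
  linarith

/-! ### Convergence to the sphere -/

theorem frontier_nonempty (hn : 0 < n) (hD : IsStrictlyStarlike D) : (frontier D).Nonempty := by
  obtain ⟨v, hv⟩ := sphere_nonempty hn
  have hv0 : v ≠ 0 := by
    rintro rfl
    simp at hv
  exact ⟨_, radius_smul_mem_frontier hD hv0⟩

theorem bddBelow_angleAt {α : ℝ} (hα : TangentCondition D α) :
    BddBelow (angleAt (frontier D) '' frontier D) :=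
  ⟨α, by rintro _ ⟨x, hx, rfl⟩; exact hα.2.2 x hx⟩

/-- The infimum of the angles is itself admissible, so the first part of the theorem applies with
the best constant. -/
theorem tangentCondition_tangentAngle (hn : 0 < n) (hD : IsStrictlyStarlike D) {α : ℝ}
    (hα : TangentCondition D α) : TangentCondition D (tangentAngle (frontier D)) := by
  obtain ⟨x, hx⟩ := frontier_nonempty hn hD
  refine ⟨hα.1.trans_le (le_csInf ⟨_, x, hx, rfl⟩ ?_),
    (csInf_le (bddBelow_angleAt hα) ⟨x, hx, rfl⟩).trans
      (angleAt_le (hα.1.trans_le (hα.2.2 x hx))),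
    fun y hy => csInf_le (bddBelow_angleAt hα) ⟨y, hy, rfl⟩⟩
  rintro _ ⟨y, hy, rfl⟩
  exact hα.2.2 y hy

theorem eventually_tangentCondition (hn : 0 < n) {D : ℝ → Set (E n)} {r : ℝ}
    (hD : SmoothlyConvergesToSphere D r) :
    ∀ᶠ t in 𝓝[>] (0 : ℝ), IsStrictlyStarlike (D t) ∧
      TangentCondition (D t) (tangentAngle (frontier (D t))) := by
  filter_upwards [Ioc_mem_nhdsGT (zero_lt_one (α := ℝ))] with t ht
  obtain ⟨h1, α, hα⟩ := hD.1 t ⟨ht.1.le, ht.2⟩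
  exact ⟨h1, tangentCondition_tangentAngle hn h1 hα⟩

theorem tendsto_tangentAngle (hn : 0 < n) {D : ℝ → Set (E n)} {r : ℝ} (hr : 0 < r)
    (hD : SmoothlyConvergesToSphere D r) :
    Tendsto (fun t => tangentAngle (frontier (D t))) (𝓝[>] 0) (𝓝 (Real.pi / 2)) := by
  have hpi := Real.pi_pos
  rw [tendsto_order]
  constructor
  · intro a ha
    obtain ⟨β, hβ, hβ2⟩ := exists_between (max_lt ha (show (0 : ℝ) < Real.pi / 2 by positivity))
    obtain ⟨haβ, hβ0⟩ := max_lt_iff.1 hβ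
    have hcos : 0 < Real.cos β := Real.cos_pos_of_mem_Ioo ⟨by linarith, hβ2⟩
    obtain ⟨ε, hε⟩ : ∃ ε, ε = min (r / 2) (Real.cos β * r / 14) := ⟨_, rfl⟩
    have hε0 : 0 < ε := by rw [hε]; positivity
    have hε1 : ε ≤ r / 2 := hε ▸ min_le_left _ _
    have hε2 : 14 * ε / r ≤ Real.cos β := by
      rw [div_le_iff₀ hr]
      have : ε ≤ Real.cos β * r / 14 := hε ▸ min_le_right _ _
      linarith
    have hev := (tendsto_order.1 hD.2).2 (ENNReal.ofReal ε) (by simpa using hε0)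
    filter_upwards [hev, eventually_tangentCondition hn hD] with t ht hDt
    refine haβ.trans_le (le_csInf ((frontier_nonempty hn hDt.1).image _) ?_)
    rintro _ ⟨x, hx, rfl⟩
    exact le_angleAt_of_ae_radius_bounds hDt.1 hDt.2 hr hε0 hε1 (by linarith) hε2
      (ae_radius_bounds hDt.1 hDt.2 hε0.le ht.le) hx
  -- No acute angle exceeds `π/2`, so the upper half needs no convergence.
  · intro a ha
    filter_upwards [eventually_tangentCondition hn hD] with t ht
    exact ht.2.2.1.trans_lt ha

theorem tendsto_cot_tangentAngle (hn : 0 < n) {D : ℝ → Set (E n)} {r : ℝ} (hr : 0 < r)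
    (hD : SmoothlyConvergesToSphere D r) :
    Tendsto (fun t => Real.cot (tangentAngle (frontier (D t)) / 2) ^ 2) (𝓝[>] 0) (𝓝 1) := by
  have hs : Real.sin (Real.pi / 2 / 2) ≠ 0 :=
    (Real.sin_pos_of_pos_of_lt_pi (by positivity) (by linarith [Real.pi_pos])).ne'
  have h1 : ContinuousAt (fun a : ℝ => (Real.cos (a / 2) / Real.sin (a / 2)) ^ 2)
      (Real.pi / 2) :=
    ((by fun_prop : ContinuousAt (fun a : ℝ => Real.cos (a / 2)) (Real.pi / 2)).div
      (by fun_prop) hs).pow 2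
  have h2 := h1.tendsto.comp (tendsto_tangentAngle hn hr hD)
  have h3 : (Real.cos (Real.pi / 2 / 2) / Real.sin (Real.pi / 2 / 2)) ^ 2 = 1 := by
    rw [div_div, show (2 : ℝ) * 2 = 4 by norm_num, Real.cos_pi_div_four, Real.sin_pi_div_four,
      div_self (by positivity), one_pow]
  rw [h3] at h2
  simp only [Real.cot_eq_cos_div_sin]
  exact h2

/-- Squeezed between `1` and the constant furnished by the best tangent angle. -/
theorem tendsto_qcConstant (hn : 0 < n) {D : ℝ → Set (E n)} {r : ℝ} (hr : 0 < r)
    (hD : SmoothlyConvergesToSphere D r) :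
    Tendsto (fun t => qcConstant (quasiInversion (frontier (D t))) {0}ᶜ {0}ᶜ)
      (𝓝[>] 0) (𝓝 1) := by
  refine tendsto_of_tendsto_of_tendsto_of_le_of_le' tendsto_const_nhds
    (tendsto_cot_tangentAngle hn hr hD) ?_ ?_
  · filter_upwards [eventually_tangentCondition hn hD] with t ht
    exact le_csInf ⟨_, isKQuasiconformal_quasiInversion hn ht.1 ht.2⟩
      fun K hK => one_le_of_isKQuasiconformal hn hK
  · filter_upwards [eventually_tangentCondition hn hD] with t ht
    exact csInf_le ⟨1, fun K hK => one_le_of_isKQuasiconformal hn hK⟩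
      (isKQuasiconformal_quasiInversion hn ht.1 ht.2)

end QuasiInv

theorem mainTheorem7 :
    (∀ n : ℕ, 2 ≤ n → ∀ (D : Set (QuasiInv.E n)) (α : ℝ),
      QuasiInv.IsStrictlyStarlike D → QuasiInv.TangentCondition D α →
        IsHomeomorph (QuasiInv.quasiInversionExt (frontier D)) ∧
        QuasiInv.IsKQuasiconformal (Real.cot (α / 2) ^ 2)
          (QuasiInv.quasiInversion (frontier D)) {0}ᶜ {0}ᶜ) ∧
    (∀ (D : Set (QuasiInv.E 2)) (α : ℝ),
      QuasiInv.IsStrictlyStarlike D → QuasiInv.TangentCondition D α →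
        (Real.cot (α / 2) ^ 2 - 1) / (Real.cot (α / 2) ^ 2 + 1) = Real.cos α ∧
        QuasiInv.IsSmallKQuasiconformal (Real.cos α)
          (QuasiInv.quasiInversion (frontier D)) {0}ᶜ {0}ᶜ) ∧
    (∀ n : ℕ, 2 ≤ n → ∀ (D : ℝ → Set (QuasiInv.E n)) (r : ℝ), 0 < r →
      QuasiInv.SmoothlyConvergesToSphere D r →
        Tendsto (fun t : ℝ => Real.cot (QuasiInv.tangentAngle (frontier (D t)) / 2) ^ 2)
          (𝓝[>] 0) (𝓝 1) ∧
        Tendsto (fun t : ℝ =>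
            QuasiInv.qcConstant (QuasiInv.quasiInversion (frontier (D t))) {0}ᶜ {0}ᶜ)
          (𝓝[>] 0) (𝓝 1)) := by
  refine ⟨fun n hn D α hD hα => ?_, fun D α hD hα => ?_, fun n hn D r hr hD => ?_⟩
  · exact ⟨QuasiInv.isHomeomorph_quasiInversionExt hD,
      QuasiInv.isKQuasiconformal_quasiInversion (by omega) hD hα⟩
  · exact ⟨QuasiInv.cot_half_sq_quotient hα.1 hα.2.1,
      QuasiInv.isSmallKQuasiconformal_quasiInversion hD hα⟩
  · exact ⟨QuasiInv.tendsto_cot_tangentAngle (by omega) hr hD,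
      QuasiInv.tendsto_qcConstant (by omega) hr hD⟩
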